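/- All graphs are finite, simple and have at least one vertex. The tensor product $G\times H$ of two graphs has vertex set $V(G)\times V(H)$, and $(u,v)$, $(u',v')$ are adjacent iff $uu'\in E(G)$ and $vv'\in E(H)$; $G^n$ is the tensor product of $n$ copies of $G$. Let $\alpha(G)$ be the maximum size of an independent set of $G$, let $i(G)=\alpha(G)/|V(G)|$, and let $A(G)=\lim_{n\to\infty} i(G^n)$. **Corollary.** The limit $A(G)$ exists for every graph $G$, every graph satisfies either $A(G)=1$ or $A(G)\le\frac12$, and there is a deterministic polynomial-time algorithm (a multi-tape Turing machine whose input is the adjacency matrix of $G$ and whose running time is bounded by a polynomial in the length of the input) that, given a graph $G$, decides which of the two alternatives holds. Moreover, its answer is "$A(G)\le\frac12$" exactly when the bipartite graph $G\times K_2$, with sides $V(G)\times\{0\}$ and $V(G)\times\{1\}$, satisfies Hall's condition: $|N_{G\times K_2}(S)|\ge|S|$ for every $S\subseteq V(G)\times\{0\}$. -/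

import Mathlib

open Filter Topology

/-- The tensor (categorical, weak) product `G × H`: two vertices are adjacent iff they are adjacent
in both coordinates. -/
def tensorProd {V W : Type*} (G : SimpleGraph V) (H : SimpleGraph W) : SimpleGraph (V × W) where
  Adj x y := G.Adj x.1 y.1 ∧ H.Adj x.2 y.2
  symm := ⟨fun _ _ h => ⟨h.1.symm, h.2.symm⟩⟩
  loopless := ⟨fun _ h => h.1.ne rfl⟩

/-- The tensor power of `G` with one factor for every element of the nonempty index type `ι`:
two vertices are adjacent iff they are adjacent in every coordinate.
The power `G ^ n` is the case `ι = Fin n`, `n ≥ 1`. -/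
def tensorPower {V : Type*} (G : SimpleGraph V) (ι : Type*) [hι : Nonempty ι] :
    SimpleGraph (ι → V) where
  Adj x y := ∀ i, G.Adj (x i) (y i)
  symm := ⟨fun _ _ h i => (h i).symm⟩
  loopless := ⟨fun _ h => hι.elim fun i => (h i).ne rfl⟩

/-- The independence ratio `i(G) = α(G) / |V(G)|`. -/
noncomputable def indepRatio {V : Type*} (G : SimpleGraph V) : ℝ :=
  (G.indepNum : ℝ) / (Nat.card V : ℝ)

/-- The sequence `i(G ^ 1), i(G ^ 2), i(G ^ 3), …`. -/
noncomputable def powerRatio {V : Type*} (G : SimpleGraph V) (k : ℕ) : ℝ :=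
  indepRatio (tensorPower G (Fin (k + 1)))

/-- The ultimate categorical independence ratio `A(G) = lim_{n → ∞} i(G ^ n)`. -/
noncomputable def ultimateRatio {V : Type*} (G : SimpleGraph V) : ℝ :=
  limUnder atTop (powerRatio G)

/-- Hall's condition for the bipartite graph `G × K₂`, whose two sides are `V × {0}` and
`V × {1}`: every set `S` of vertices on the side `V × {0}` has at least `|S|` neighbours. -/
def HallConditionDouble {V : Type*} (G : SimpleGraph V) : Prop :=
  ∀ S : Set (V × Fin 2), (∀ x ∈ S, x.2 = 0) →
    S.ncard ≤ (⋃ x ∈ S, (tensorProd G (⊤ : SimpleGraph (Fin 2))).neighborSet x).ncard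

/-- The inputs of the decision problem: a number `n ≥ 1` of vertices and a graph on
`{0, …, n - 1}`. -/
abbrev InputGraph : Type := Σ n : ℕ+, SimpleGraph (Fin n)

/-- Row `i` of the adjacency matrix, with `some true` for the entry `1`, `some false` for the
entry `0`, followed by the end-of-row marker `none`. -/
noncomputable def encodeRow {n : ℕ} (G : SimpleGraph (Fin n)) (i : Fin n) : List (Option Bool) :=
  open scoped Classical in
  (List.finRange n).map (fun j => some (decide (G.Adj i j))) ++ [none]

/-- The input word of a graph: the rows of its adjacency matrix, one after another.
It has length `n * (n + 1)`. -/
noncomputable def encodeGraph (G : InputGraph) : List (Option Bool) :=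
  (List.finRange G.1).flatMap (encodeRow G.2)

theorem encodeRow_length {n : ℕ} (G : SimpleGraph (Fin n)) (i : Fin n) :
    (encodeRow G i).length = n + 1 := by
  simp [encodeRow]

theorem encodeGraph_length (G : InputGraph) :
    (encodeGraph G).length = (G.1 : ℕ) * (G.1 + 1) := by
  simp [encodeGraph, List.length_flatMap, encodeRow_length]

theorem flatMap_inj_of_length {α β : Type*} (f g : α → List β)
    (h : ∀ a, (f a).length = (g a).length) (l : List α) (hl : l.flatMap f = l.flatMap g) :
    ∀ a ∈ l, f a = g a := by
  induction l with
  | nil => simp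
  | cons b l ih =>
    rw [List.flatMap_cons, List.flatMap_cons] at hl
    obtain ⟨h1, h2⟩ := List.append_inj hl (h b)
    intro a ha
    rcases List.mem_cons.1 ha with rfl | ha
    · exact h1
    · exact ih h2 a ha

/-- Different graphs have different input words. -/
theorem encodeGraph_injective : Function.Injective encodeGraph := by
  rintro ⟨n, G⟩ ⟨m, H⟩ h
  have hl := congrArg List.length h
  rw [encodeGraph_length, encodeGraph_length] at hl
  dsimp only at hl
  have hnm : n = m := by
    apply PNat.eq
    rcases lt_trichotomy (n : ℕ) m with hlt | heq | hlt
    · nlinarith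
    · exact heq
    · nlinarith
  subst hnm
  have hrow := flatMap_inj_of_length (encodeRow G) (encodeRow H)
    (fun i => by rw [encodeRow_length, encodeRow_length]) _ h
  have hGH : G = H := by
    ext i j
    have := hrow i (List.mem_finRange i)
    simp only [encodeRow, List.append_cancel_right_eq] at this
    have := List.map_inj_left.1 this j (List.mem_finRange j)
    simpa using this
  rw [hGH]

/-! Everything turns on one property: an injection `f : V → V` with `f v` adjacent to `v` for all
`v`. By Hall's marriage theorem it is equivalent to Hall's condition for `G × K₂`.

If `f` exists, it acts coordinatewise on every tensor power. An independent set is disjoint from its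
image under such an injection, so all ratios, and hence the limit, are at most 1/2. The limit exists
because adding a free coordinate to an independent set keeps its density, so the ratios increase and
are bounded by 1.

If `f` does not exist, there are disjoint sets `I`, `N` with `|N| < |I|` and `N` containing all
neighbours of `I`. Weights slightly below 1 on `I`, slightly above 1 on `N` and 1 elsewhere can be
chosen with mean less than 1 and with product at least 1 along every edge. Tuples whose weights
multiply to less than 1 are then independent in the power, and a Markov estimate shows that the
other tuples have exponentially small density. So the limit is 1.

The algorithm is an auction for bipartite matching. Vertices bid for columns; a bid goes to a
cheapest neighbour, raises its price by one and evicts the former owner. A bidder whose neighbours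
all cost at least `n` certifies that no injection exists (`Fair.not_hasNeighborInjection`). Prices
never exceed `n`, so there are at most `n ^ 2` successful bids. The auction suits stacks: prices are
kept as a 0/1 table with a one at `(r, j)` iff column `j` costs at most `r`, so a price rise clears
one bit, and positions on stacks replace indices and counters. -/

/-- Every vertex can be matched with a neighbour, injectively. -/
def HasNeighborInjection {V : Type*} (G : SimpleGraph V) : Prop :=
  ∃ f : V → V, Function.Injective f ∧ ∀ v, G.Adj v (f v)

theorem HasNeighborInjection.tensorPower {V : Type*} {G : SimpleGraph V}
    (h : HasNeighborInjection G) (ι : Type*) [Nonempty ι] :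
    HasNeighborInjection (tensorPower G ι) := by
  obtain ⟨f, hf, hadj⟩ := h
  exact ⟨fun x => f ∘ x, hf.comp_left, fun x i => hadj (x i)⟩

/-! ### Hall's theorem and neighbour injections. -/

section Hall

variable {V : Type*} [Finite V] {G : SimpleGraph V}

theorem HasNeighborInjection.hallConditionDouble (h : HasNeighborInjection G) :
    HallConditionDouble G := by
  obtain ⟨f, hf, hadj⟩ := h
  intro S hS
  refine Set.ncard_le_ncard_of_injOn (fun x => (f x.1, 1)) (fun x hx => ?_)
    (fun x hx y hy hxy => ?_) (Set.toFinite _)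
  · simp only [Set.mem_iUnion]
    refine ⟨x, hx, hadj x.1, ?_⟩
    rw [hS x hx]
    exact zero_ne_one
  · refine Prod.ext (hf (Prod.ext_iff.1 hxy).1) ?_
    rw [hS x hx, hS y hy]

/-- If Hall's condition fails, some independent set `I` has fewer neighbours than elements. -/
theorem exists_disjoint_of_not_hasNeighborInjection (h : ¬ HasNeighborInjection G) :
    ∃ I N : Finset V, Disjoint I N ∧ N.card < I.card ∧ ∀ v ∈ I, ∀ u, G.Adj v u → u ∈ N := by
  classical
  have := Fintype.ofFinite V
  have hall := Finset.all_card_le_biUnion_card_iff_exists_injective fun v => G.neighborFinset v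
  have : ¬ ∀ s : Finset V, s.card ≤ (s.biUnion fun v => G.neighborFinset v).card := by
    rw [hall]
    simpa [HasNeighborInjection] using h
  push Not at this
  obtain ⟨s, hs⟩ := this
  set B := s.biUnion fun v => G.neighborFinset v with hB
  have hmem : ∀ v ∈ s, ∀ u, G.Adj v u → u ∈ B := fun v hv u hu =>
    Finset.mem_biUnion.2 ⟨v, hv, by simpa using hu⟩
  -- Removing the common part `s ∩ B` keeps the deficiency. A neighbour of a vertex outside `B`
  -- cannot lie in `s`, since adjacency is symmetric.
  refine ⟨s \ B, B \ s, disjoint_sdiff_sdiff, ?_, fun v hv u hu => ?_⟩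
  · have h1 := Finset.card_sdiff_add_card_inter s B
    have h2 := Finset.card_sdiff_add_card_inter B s
    rw [Finset.inter_comm] at h2
    omega
  · rw [Finset.mem_sdiff] at hv ⊢
    exact ⟨hmem v hv.1 u hu, fun hus => hv.2 (hmem u hus v hu.symm)⟩

theorem hallConditionDouble_iff_hasNeighborInjection :
    HallConditionDouble G ↔ HasNeighborInjection G := by
  classical
  refine ⟨fun h => ?_, HasNeighborInjection.hallConditionDouble⟩
  have := Fintype.ofFinite V
  suffices h' : ∃ f : V → V, Function.Injective f ∧ ∀ v, f v ∈ G.neighborFinset v by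
    simpa [HasNeighborInjection] using h'
  rw [← Finset.all_card_le_biUnion_card_iff_exists_injective]
  intro s
  have hS := h ((fun v => (v, 0)) '' (s : Set V)) (by rintro _ ⟨v, -, rfl⟩; rfl)
  rw [Set.ncard_image_of_injective _ (Prod.mk_left_injective _), Set.ncard_coe_finset] at hS
  refine hS.trans ?_
  rw [← Set.ncard_coe_finset]
  refine Set.ncard_le_ncard_of_injOn Prod.fst (fun x hx => ?_) (fun x hx y hy hxy => ?_)
    (Set.toFinite _)
  · simp only [Set.mem_iUnion] at hx
    obtain ⟨_, ⟨v, hv, rfl⟩, hvx⟩ := hx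
    exact Finset.mem_coe.2 (Finset.mem_biUnion.2 ⟨v, hv, by simpa using hvx.1⟩)
  · have hone : ∀ z ∈ ⋃ x ∈ (fun v => (v, (0 : Fin 2))) '' (s : Set V),
        (tensorProd G (⊤ : SimpleGraph (Fin 2))).neighborSet x, z.2 = 1 := by
      intro z hz
      simp only [Set.mem_iUnion] at hz
      obtain ⟨_, ⟨v, hv, rfl⟩, hvz⟩ := hz
      exact Fin.eq_one_of_ne_zero _ (Ne.symm hvz.2)
    exact Prod.ext hxy ((hone x hx).trans (hone y hy).symm)

end Hall

/-! ### Independence ratios of powers: existence of the limit and the dichotomy. -/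

section Ratio

variable {V : Type*} [Finite V] {G : SimpleGraph V}

theorem indepRatio_le_one : indepRatio G ≤ 1 := by
  obtain ⟨s, hs⟩ := G.exists_isNIndepSet_indepNum
  have := Fintype.ofFinite V
  refine div_le_one_of_le₀ ?_ (Nat.cast_nonneg _)
  rw [← hs.card_eq, Nat.card_eq_fintype_card]
  exact_mod_cast s.card_le_univ

theorem le_indepRatio {s : Finset V} (hs : ∀ x ∈ s, ∀ y ∈ s, ¬ G.Adj x y) :
    (s.card : ℝ) / Nat.card V ≤ indepRatio G := by
  refine div_le_div_of_nonneg_right ?_ (Nat.cast_nonneg _)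
  have : G.IsIndepSet (s : Set V) := fun x hx y hy _ => hs x hx y hy
  exact_mod_cast this.card_le_indepNum

/-- An independent set and its image under the injection are disjoint and equally large. -/
theorem HasNeighborInjection.indepRatio_le (h : HasNeighborInjection G) : indepRatio G ≤ 1 / 2 := by
  classical
  have := Fintype.ofFinite V
  obtain ⟨f, hf, hadj⟩ := h
  obtain ⟨s, hs⟩ := G.exists_isNIndepSet_indepNum
  have hdisj : Disjoint s (s.image f) := by
    rw [Finset.disjoint_left]
    intro y hy hy'
    obtain ⟨x, hx, rfl⟩ := Finset.mem_image.1 hy'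
    exact hs.isIndepSet hx hy (hadj x).ne (hadj x)
  have hcard : (s ∪ s.image f).card ≤ Fintype.card V := Finset.card_le_univ _
  rw [Finset.card_union_of_disjoint hdisj, Finset.card_image_of_injective _ hf, hs.card_eq] at hcard
  rw [indepRatio, Nat.card_eq_fintype_card]
  refine div_le_of_le_mul₀ (Nat.cast_nonneg _) (by norm_num) ?_
  have : (G.indepNum : ℝ) + G.indepNum ≤ Fintype.card V := by exact_mod_cast hcard
  linarith

theorem HasNeighborInjection.powerRatio_le (h : HasNeighborInjection G) (k : ℕ) :
    powerRatio G k ≤ 1 / 2 :=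
  (h.tensorPower _).indepRatio_le

theorem powerRatio_le_one (k : ℕ) : powerRatio G k ≤ 1 := indepRatio_le_one

/-- If `s` is independent, so is `s × V` in the next power, with the same density. -/
theorem powerRatio_le_succ [Nonempty V] (k : ℕ) : powerRatio G k ≤ powerRatio G (k + 1) := by
  classical
  have := Fintype.ofFinite V
  obtain ⟨s, hs⟩ := (tensorPower G (Fin (k + 1))).exists_isNIndepSet_indepNum
  let e : (Fin (k + 1) → V) × V → (Fin (k + 1 + 1) → V) := fun z => Fin.snoc z.1 z.2
  have he : Function.Injective e := by
    rintro ⟨x, v⟩ ⟨y, w⟩ h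
    have h' : (Fin.snoc x v : Fin (k + 1 + 1) → V) = Fin.snoc y w := h
    obtain ⟨h1, h2⟩ := Fin.snoc_injective2 h'
    rw [h1, h2]
  refine le_trans (le_of_eq ?_) (le_indepRatio (s := (s ×ˢ Finset.univ).image e) ?_)
  · rw [Finset.card_image_of_injective _ he, Finset.card_product, hs.card_eq, powerRatio,
      indepRatio, Finset.card_univ]
    simp only [Nat.card_eq_fintype_card, Fintype.card_fun, Fintype.card_fin]
    have hV : (Fintype.card V : ℝ) ≠ 0 := Nat.cast_ne_zero.2 Fintype.card_ne_zero
    push_cast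
    rw [pow_succ _ (k + 1), mul_div_mul_right _ _ hV]
  · intro x' hx' y' hy' hxy
    obtain ⟨⟨x, v⟩, hx, rfl⟩ := Finset.mem_image.1 hx'
    obtain ⟨⟨y, w⟩, hy, rfl⟩ := Finset.mem_image.1 hy'
    have hadj : (tensorPower G (Fin (k + 1))).Adj x y := fun i => by
      simpa [e] using hxy i.castSucc
    rw [Finset.mem_product] at hx hy
    exact hs.isIndepSet hx.1 hy.1 hadj.ne hadj

theorem tendsto_powerRatio [Nonempty V] :
    Tendsto (powerRatio G) atTop (𝓝 (ultimateRatio G)) :=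
  tendsto_nhds_limUnder ⟨_, tendsto_atTop_ciSup (monotone_nat_of_le_succ powerRatio_le_succ)
    ⟨1, by rintro _ ⟨k, rfl⟩; exact powerRatio_le_one k⟩⟩

theorem HasNeighborInjection.ultimateRatio_le [Nonempty V] (h : HasNeighborInjection G) :
    ultimateRatio G ≤ 1 / 2 :=
  le_of_tendsto' tendsto_powerRatio h.powerRatio_le

/-- If adjacent vertices have weights with product at least one, the vertices of the tensor power
of weight less than one are independent. -/
theorem le_powerRatio_of_weight [Fintype V] [Nonempty V] {wt : V → ℝ} (hpos : ∀ v, 0 < wt v)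
    (hadj : ∀ u v, G.Adj u v → 1 ≤ wt u * wt v) (k : ℕ) :
    1 - ((∑ v, wt v) / Fintype.card V) ^ (k + 1) ≤ powerRatio G k := by
  classical
  set good := Finset.univ.filter fun x : Fin (k + 1) → V => ∏ i, wt (x i) < 1 with hgood
  have hindep : ∀ x ∈ good, ∀ y ∈ good, ¬ (tensorPower G (Fin (k + 1))).Adj x y := by
    intro x hx y hy hxy
    have h1 : 1 ≤ ∏ i, wt (x i) * wt (y i) :=
      Finset.one_le_prod fun i _ => hadj _ _ (hxy i)
    rw [Finset.prod_mul_distrib] at h1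
    have hx' := (Finset.mem_filter.1 hx).2
    have hy' := (Finset.mem_filter.1 hy).2
    have hx0 : 0 < ∏ i, wt (x i) := Finset.prod_pos fun i _ => hpos _
    have hy0 : 0 < ∏ i, wt (y i) := Finset.prod_pos fun i _ => hpos _
    nlinarith
  -- Markov's inequality: each bad tuple has weight product at least 1, and the products over all
  -- tuples sum to the power of the total weight.
  have hbad : ((goodᶜ).card : ℝ) ≤ (∑ v, wt v) ^ (k + 1) := by
    rw [Fintype.sum_pow, Finset.card_eq_sum_ones]
    push_cast
    refine (Finset.sum_le_sum fun x hx => ?_).trans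
      (Finset.sum_le_sum_of_subset_of_nonneg (Finset.subset_univ goodᶜ) fun x _ _ =>
        Finset.prod_nonneg fun i _ => (hpos _).le)
    simpa [hgood] using hx
  have hcard : ((good.card : ℝ) + (goodᶜ).card) = (Fintype.card V : ℝ) ^ (k + 1) := by
    have := Finset.card_add_card_compl good
    rw [Fintype.card_fun, Fintype.card_fin] at this
    exact_mod_cast this
  refine le_trans ?_ (le_indepRatio hindep)
  rw [Nat.card_eq_fintype_card, Fintype.card_fun, Fintype.card_fin]
  push_cast
  have hV : (0 : ℝ) < (Fintype.card V : ℝ) ^ (k + 1) :=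
    pow_pos (Nat.cast_pos.2 Fintype.card_pos) _
  rw [div_pow, le_div_iff₀ hV, sub_mul, div_mul_cancel₀ _ hV.ne', one_mul]
  linarith

/-- A Hall violator yields weights of mean less than 1, and `le_powerRatio_of_weight` then pushes
the ratios to 1. -/
theorem ultimateRatio_eq_one [Nonempty V] (h : ¬ HasNeighborInjection G) : ultimateRatio G = 1 := by
  classical
  have := Fintype.ofFinite V
  obtain ⟨I, N, hdisj, hcard, hN⟩ := exists_disjoint_of_not_hasNeighborInjection h
  set a : ℝ := (I.card : ℝ) with ha
  have ha0 : 0 < a := Nat.cast_pos.2 (by omega)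
  -- The weights on `I` and `N` are reciprocal, so edges between them have product exactly 1. Every
  -- edge meeting `I` is of this kind.
  let wt : V → ℝ := fun v => if v ∈ I then a / (a + 1) else if v ∈ N then (a + 1) / a else 1
  have hpos : ∀ v, 0 < wt v := by
    intro v
    simp only [wt]
    split_ifs <;> positivity
  have hge : ∀ v ∉ I, 1 ≤ wt v := by
    intro v hv
    simp only [wt, if_neg hv]
    split_ifs
    · rw [one_le_div ha0]; linarith
    · exact le_rfl
  have hprod : ∀ u ∈ I, ∀ v, G.Adj u v → 1 ≤ wt u * wt v := by
    intro u hu v huv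
    have hv := hN u hu v huv
    have hvI : v ∉ I := fun hvI => Finset.disjoint_left.1 hdisj hvI hv
    simp only [wt, if_pos hu, if_neg hvI, if_pos hv]
    exact le_of_eq (by field_simp)
  have hadj : ∀ u v, G.Adj u v → 1 ≤ wt u * wt v := by
    intro u v huv
    by_cases hu : u ∈ I
    · exact hprod u hu v huv
    · by_cases hv : v ∈ I
      · rw [mul_comm]; exact hprod v hv u huv.symm
      · exact one_le_mul_of_one_le_of_one_le (hge u hu) (hge v hv)
  have hsum : ∑ v, wt v < Fintype.card V := by
    have hwt : ∀ v, wt v = 1 - (if v ∈ I then 1 / (a + 1) else 0) + (if v ∈ N then 1 / a else 0) := by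
      intro v
      by_cases hv : v ∈ I
      · have := Finset.disjoint_left.1 hdisj hv
        simp only [wt, if_pos hv, if_neg this]
        field_simp
        ring
      · by_cases hv' : v ∈ N
        · simp only [wt, if_neg hv, if_pos hv']
          field_simp
          ring
        · simp [wt, hv, hv']
    simp only [hwt, Finset.sum_add_distrib, Finset.sum_sub_distrib, Finset.sum_ite_mem,
      Finset.univ_inter, Finset.sum_const, nsmul_eq_mul, Finset.card_univ, mul_one]
    rw [← ha]
    have hb : (N.card : ℝ) + 1 ≤ a := by rw [ha]; exact_mod_cast hcard
    -- The gain on `N` is at most `(a - 1) / a`, less than the loss `a / (a + 1)` on `I`, because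
    -- `(a - 1) * (a + 1) < a ^ 2`.
    have : (N.card : ℝ) * (1 / a) < a * (1 / (a + 1)) := by
      rw [mul_one_div, mul_one_div, div_lt_div_iff₀ ha0 (by positivity)]
      nlinarith
    linarith
  have hV : (0 : ℝ) < Fintype.card V := Nat.cast_pos.2 Fintype.card_pos
  have hlim : Tendsto (fun k : ℕ => 1 - ((∑ v, wt v) / Fintype.card V) ^ (k + 1)) atTop (𝓝 1) := by
    have := (tendsto_pow_atTop_nhds_zero_of_lt_one
      (div_nonneg (Finset.sum_nonneg fun v _ => (hpos v).le) hV.le)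
      ((div_lt_one hV).2 hsum)).comp (tendsto_add_atTop_nat 1)
    simpa [Function.comp_def] using this.const_sub 1
  exact tendsto_nhds_unique tendsto_powerRatio
    (tendsto_of_tendsto_of_tendsto_of_le_of_le hlim tendsto_const_nhds
      (le_powerRatio_of_weight hpos hadj) powerRatio_le_one)

end Ratio

/-! ### Structured programs compiled to `TM2` machines, with time bounds. -/

section StackPrograms

open Turing

/-- An elementary stack operation of a `TM2` machine. -/
inductive StackOp {K : Type} (Γ : K → Type) (σ : Type) : Type
  | push (k : K) (f : σ → Γ k)
  | pop (k : K) (f : σ → Option (Γ k) → σ)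
  | load (f : σ → σ)

/-- Structured programs for multi-stack machines. A loop first updates the internal state according
to the top of the stack `k` and then tests it. -/
inductive StackProg {K : Type} (Γ : K → Type) (σ : Type) : Type
  | exec (ops : List (StackOp Γ σ))
  | seq (P Q : StackProg Γ σ)
  | ite (p : σ → Bool) (P Q : StackProg Γ σ)
  | loop (k : K) (f : σ → Option (Γ k) → σ) (p : σ → Bool) (P : StackProg Γ σ)

variable {K : Type} {Γ : K → Type} {σ : Type}

/-- The statement that performs an elementary operation and continues with `q`. -/
def StackOp.stmt {Λ : Type} : StackOp Γ σ → TM2.Stmt Γ Λ σ → TM2.Stmt Γ Λ σ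
  | .push k f, q => .push k f q
  | .pop k f, q => .pop k f q
  | .load f, q => .load f q

/-- The effect of an elementary operation on the internal state and the stacks. -/
def StackOp.run [DecidableEq K] :
    StackOp Γ σ → σ × (∀ k, List (Γ k)) → σ × (∀ k, List (Γ k))
  | .push k f, c => (c.1, Function.update c.2 k (f c.1 :: c.2 k))
  | .pop k f, c => (f c.1 (c.2 k).head?, Function.update c.2 k (c.2 k).tail)
  | .load f, c => (f c.1, c.2)

namespace StackProg

/-- The labels of the machine code of a program. -/
def Lab : StackProg Γ σ → Type
  | exec _ => Unit
  | seq P Q => P.Lab ⊕ Q.Lab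
  | ite _ P Q => Option (P.Lab ⊕ Q.Lab)
  | loop _ _ _ P => Option P.Lab

/-- A program has finitely many labels. -/
@[reducible] def labFintype : (P : StackProg Γ σ) → Fintype P.Lab
  | exec _ => inferInstanceAs (Fintype Unit)
  | seq P Q => @instFintypeSum _ _ P.labFintype Q.labFintype
  | ite _ P Q => @instFintypeOption _ (@instFintypeSum _ _ P.labFintype Q.labFintype)
  | loop _ _ _ P => @instFintypeOption _ P.labFintype

/-- The label at which a program starts. -/
def entry : (P : StackProg Γ σ) → P.Lab
  | exec _ => ()
  | seq P _ => Sum.inl P.entry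
  | ite _ _ _ => none
  | loop _ _ _ _ => none

/-- The machine code of a program whose labels are embedded by `e` and which continues at the
label `next`. -/
def code {Λ : Type} : (P : StackProg Γ σ) → (P.Lab → Λ) → Λ → P.Lab → TM2.Stmt Γ Λ σ
  | exec ops, _, next, _ => ops.foldr StackOp.stmt (.goto fun _ => next)
  | seq P Q, e, next, l => match l with
    | Sum.inl l => P.code (fun l => e (Sum.inl l)) (e (Sum.inr Q.entry)) l
    | Sum.inr l => Q.code (fun l => e (Sum.inr l)) next l
  | ite p P Q, e, next, l => match l with
    | none => .branch p (.goto fun _ => e (some (Sum.inl P.entry)))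
        (.goto fun _ => e (some (Sum.inr Q.entry)))
    | some (Sum.inl l) => P.code (fun l => e (some (Sum.inl l))) next l
    | some (Sum.inr l) => Q.code (fun l => e (some (Sum.inr l))) next l
  | loop k f p P, e, next, l => match l with
    | none => .peek k f (.branch p (.goto fun _ => e (some P.entry)) (.goto fun _ => next))
    | some l => P.code (fun l => e (some l)) (e none) l

variable [DecidableEq K]

/-- Started in `c`, the program `P` ends in `c'` after at most `t` steps. -/
def Runs (P : StackProg Γ σ) (c c' : σ × (∀ k, List (Γ k))) (t : ℕ) : Prop :=
  ∀ (Λ : Type) (M : Λ → TM2.Stmt Γ Λ σ) (e : P.Lab → Λ) (next : Λ),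
    (∀ l, M (e l) = P.code e next l) →
    ∃ m ≤ t, (flip Bind.bind (TM2.step M))^[m] (some ⟨some (e P.entry), c.1, c.2⟩) =
      some ⟨some next, c'.1, c'.2⟩

theorem Runs.mono {P : StackProg Γ σ} {c c' : σ × (∀ k, List (Γ k))} {s t : ℕ}
    (h : P.Runs c c' s) (hst : s ≤ t) : P.Runs c c' t := by
  intro Λ M e next hM
  obtain ⟨m, hm, h⟩ := h Λ M e next hM
  exact ⟨m, hm.trans hst, h⟩

/-- A straight-line block is a single statement ending in a jump, hence costs one machine step
however long it is. -/
theorem stepAux_foldr {Λ : Type} (ops : List (StackOp Γ σ)) (next : Λ)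
    (c : σ × (∀ k, List (Γ k))) :
    TM2.stepAux (ops.foldr StackOp.stmt (.goto fun _ => next)) c.1 c.2 =
      ⟨some next, (ops.foldl (fun c op => op.run c) c).1,
        (ops.foldl (fun c op => op.run c) c).2⟩ := by
  induction ops generalizing c with
  | nil => simp
  | cons op ops ih =>
    have := ih (op.run c)
    cases op <;> simpa [StackOp.stmt, StackOp.run] using this

theorem runs_exec (ops : List (StackOp Γ σ)) (c : σ × (∀ k, List (Γ k))) :
    (exec ops).Runs c (ops.foldl (fun c op => op.run c) c) 1 := by
  intro Λ M e next hM
  refine ⟨1, le_rfl, ?_⟩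
  simp [flip, hM, code, stepAux_foldr]

/-- `Runs` quantifies over every machine that contains the code and over the label that follows it,
so both pieces can be run inside the same ambient machine. -/
theorem Runs.seq {P Q : StackProg Γ σ} {c c' c'' : σ × (∀ k, List (Γ k))} {s t : ℕ}
    (hP : P.Runs c c' s) (hQ : Q.Runs c' c'' t) : (StackProg.seq P Q).Runs c c'' (s + t) := by
  intro Λ M e next hM
  obtain ⟨m, hm, h⟩ := hP Λ M (fun l => e (Sum.inl l)) (e (Sum.inr Q.entry))
    (fun l => hM (Sum.inl l))
  obtain ⟨m', hm', h'⟩ := hQ Λ M (fun l => e (Sum.inr l)) next (fun l => hM (Sum.inr l))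
  refine ⟨m' + m, by omega, ?_⟩
  rw [Function.iterate_add_apply]
  exact (congrArg _ h).trans h'

theorem Runs.ite_true {p : σ → Bool} {P Q : StackProg Γ σ} {c c' : σ × (∀ k, List (Γ k))} {t : ℕ}
    (hp : p c.1 = true) (h : P.Runs c c' t) : (ite p P Q).Runs c c' (t + 1) := by
  intro Λ M e next hM
  obtain ⟨m, hm, h⟩ := h Λ M (fun l => e (some (Sum.inl l))) next
    (fun l => hM (some (Sum.inl l)))
  refine ⟨m + 1, by omega, ?_⟩
  rw [Function.iterate_add_apply, ← h]
  congr 1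
  change (some (TM2.stepAux (M (e (ite p P Q).entry)) c.1 c.2) : Option _) = _
  rw [hM]
  simp [code, entry, hp]

theorem Runs.ite_false {p : σ → Bool} {P Q : StackProg Γ σ} {c c' : σ × (∀ k, List (Γ k))} {t : ℕ}
    (hp : p c.1 = false) (h : Q.Runs c c' t) : (ite p P Q).Runs c c' (t + 1) := by
  intro Λ M e next hM
  obtain ⟨m, hm, h⟩ := h Λ M (fun l => e (some (Sum.inr l))) next
    (fun l => hM (some (Sum.inr l)))
  refine ⟨m + 1, by omega, ?_⟩
  rw [Function.iterate_add_apply, ← h]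
  congr 1
  change (some (TM2.stepAux (M (e (ite p P Q).entry)) c.1 c.2) : Option _) = _
  rw [hM]
  simp [code, entry, hp]

theorem Runs.loop_done {k : K} {f : σ → Option (Γ k) → σ} {p : σ → Bool} {P : StackProg Γ σ}
    {c : σ × (∀ k, List (Γ k))} (hp : p (f c.1 (c.2 k).head?) = false) :
    (loop k f p P).Runs c (f c.1 (c.2 k).head?, c.2) 1 := by
  intro Λ M e next hM
  refine ⟨1, le_rfl, ?_⟩
  change (some (TM2.stepAux (M (e (loop k f p P).entry)) c.1 c.2) : Option _) = _
  rw [hM]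
  simp [code, entry, hp]

/-- The body continues at the loop's own test `e none`, after which the remaining iterations are
again a run of the loop. -/
theorem Runs.loop_step {k : K} {f : σ → Option (Γ k) → σ} {p : σ → Bool} {P : StackProg Γ σ}
    {c c' c'' : σ × (∀ k, List (Γ k))} {s t : ℕ} (hp : p (f c.1 (c.2 k).head?) = true)
    (hP : P.Runs (f c.1 (c.2 k).head?, c.2) c' s) (h : (loop k f p P).Runs c' c'' t) :
    (loop k f p P).Runs c c'' (s + 1 + t) := by
  intro Λ M e next hM
  obtain ⟨m, hm, hP⟩ := hP Λ M (fun l => e (some l)) (e none) (fun l => hM (some l))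
  obtain ⟨m', hm', h⟩ := h Λ M e next hM
  refine ⟨m' + (m + 1), by omega, ?_⟩
  rw [Function.iterate_add_apply, ← h]
  congr 1
  rw [Function.iterate_add_apply]
  refine Eq.trans ?_ hP
  congr 1
  change (some (TM2.stepAux (M (e (loop k f p P).entry)) c.1 c.2) : Option _) = _
  rw [hM]
  simp [code, entry, hp]

/-- The machine that runs the program `P` and halts. -/
def toFinTM2 [Fintype K] [Fintype σ] (P : StackProg Γ σ) (k₀ k₁ : K) [Fintype (Γ k₀)] (v : σ) :
    FinTM2 where
  k₀ := k₀
  k₁ := k₁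
  Γ := Γ
  Λ := Option P.Lab
  main := some P.entry
  ΛFin := @instFintypeOption _ P.labFintype
  σ := σ
  initialState := v
  m l := match l with
    | none => .halt
    | some l => P.code some none l

theorem Runs.evalsTo [Fintype K] [Fintype σ] {P : StackProg Γ σ} {k₀ k₁ : K} [Fintype (Γ k₀)]
    {v v' : σ} {S S' : ∀ k, List (Γ k)} {t : ℕ} (h : P.Runs (v, S) (v', S') t) :
    Nonempty (StateTransition.EvalsToInTime (P.toFinTM2 k₀ k₁ v).step
      (⟨some (some P.entry), v, S⟩ : TM2.Cfg Γ (Option P.Lab) σ)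
      (some (⟨none, v', S'⟩ : TM2.Cfg Γ (Option P.Lab) σ)) (t + 1)) := by
  obtain ⟨m, hm, h⟩ := h (Option P.Lab) (P.toFinTM2 k₀ k₁ v).m some none (fun l => rfl)
  -- The additional step executes `halt` at the label `none`.
  refine ⟨⟨⟨1 + m, ?_⟩, (by omega : 1 + m ≤ t + 1)⟩⟩
  rw [Function.iterate_add_apply]
  exact congrArg _ h

end StackProg

end StackPrograms

/-! ### Stacks, words and basic moves of the machine. -/

namespace HallMachine

open StackProg

/-- The work stacks of the machine: unmatched rows, price table, owners of the columns, and four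
auxiliary stacks. -/
inductive Reg
  | U | T | O | A | B | C | D
  deriving DecidableEq

instance : Fintype Reg :=
  ⟨{.U, .T, .O, .A, .B, .C, .D}, fun k => by cases k <;> decide⟩

/-- The stack alphabets; `none` is the output stack. -/
abbrev Sym : Option Reg → Type
  | none => Bool
  | some _ => Option Bool

/-- The internal states of the machine. -/
structure Mode where
  /-- the last symbol read from the row -/
  x : Option (Option Bool)
  /-- the last symbol read from the price table -/
  y : Option (Option Bool)
  /-- a column has been found -/
  hit : Bool
  /-- the search for a column has failed -/
  bad : Bool
  deriving DecidableEq, Fintype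

/-- The initial internal state. -/
def Mode.init : Mode := ⟨none, none, false, false⟩

/-- Programs of the machine. -/
abbrev Prog := StackProg Sym Mode

/-- The stacks with the given contents. -/
def mem (w : List Bool) (u t o a b c d : List (Option Bool)) : ∀ k, List (Sym k)
  | none => w
  | some .U => u
  | some .T => t
  | some .O => o
  | some .A => a
  | some .B => b
  | some .C => c
  | some .D => d

section mem

variable (w : List Bool) (u t o a b c d l : List (Option Bool))

@[simp] theorem mem_out : mem w u t o a b c d none = w := rfl
@[simp] theorem mem_U : mem w u t o a b c d (some .U) = u := rfl
@[simp] theorem mem_T : mem w u t o a b c d (some .T) = t := rfl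
@[simp] theorem mem_O : mem w u t o a b c d (some .O) = o := rfl
@[simp] theorem mem_A : mem w u t o a b c d (some .A) = a := rfl
@[simp] theorem mem_B : mem w u t o a b c d (some .B) = b := rfl
@[simp] theorem mem_C : mem w u t o a b c d (some .C) = c := rfl
@[simp] theorem mem_D : mem w u t o a b c d (some .D) = d := rfl

@[simp] theorem update_mem_out (l : List Bool) :
    Function.update (mem w u t o a b c d) none l = mem l u t o a b c d := by
  funext k; rcases k with _ | _ | _ <;> rfl
@[simp] theorem update_mem_U :
    Function.update (mem w u t o a b c d) (some .U) l = mem w l t o a b c d := by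
  funext k; rcases k with _ | _ | _ <;> rfl
@[simp] theorem update_mem_T :
    Function.update (mem w u t o a b c d) (some .T) l = mem w u l o a b c d := by
  funext k; rcases k with _ | _ | _ <;> rfl
@[simp] theorem update_mem_O :
    Function.update (mem w u t o a b c d) (some .O) l = mem w u t l a b c d := by
  funext k; rcases k with _ | _ | _ <;> rfl
@[simp] theorem update_mem_A :
    Function.update (mem w u t o a b c d) (some .A) l = mem w u t o l b c d := by
  funext k; rcases k with _ | _ | _ <;> rfl
@[simp] theorem update_mem_B :
    Function.update (mem w u t o a b c d) (some .B) l = mem w u t o a l c d := by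
  funext k; rcases k with _ | _ | _ <;> rfl
@[simp] theorem update_mem_C :
    Function.update (mem w u t o a b c d) (some .C) l = mem w u t o a b l d := by
  funext k; rcases k with _ | _ | _ <;> rfl
@[simp] theorem update_mem_D :
    Function.update (mem w u t o a b c d) (some .D) l = mem w u t o a b c l := by
  funext k; rcases k with _ | _ | _ <;> rfl

end mem

/-- Record the top symbol of a stack in the internal state. -/
def Mode.read (v : Mode) (h : Option (Option Bool)) : Mode := { v with x := h }

@[simp] theorem Mode.read_x (v : Mode) (h : Option (Option Bool)) : (v.read h).x = h := rfl
@[simp] theorem Mode.read_hit (v : Mode) (h : Option (Option Bool)) : (v.read h).hit = v.hit := rfl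
@[simp] theorem Mode.read_bad (v : Mode) (h : Option (Option Bool)) : (v.read h).bad = v.bad := rfl
@[simp] theorem Mode.read_read (v : Mode) (h h' : Option (Option Bool)) :
    (v.read h).read h' = v.read h' := rfl

/-- The top symbol is a bit. -/
def isBit : Option (Option Bool) → Bool
  | some (some _) => true
  | _ => false

@[simp] theorem isBit_none : isBit none = false := rfl
@[simp] theorem isBit_some_none : isBit (some none) = false := rfl
@[simp] theorem isBit_some_some (b : Bool) : isBit (some (some b)) = true := rfl

/-- Push the last symbol read. -/
abbrev pushX (k : Reg) : StackOp Sym Mode := .push (some k) fun v => v.x.getD none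

/-- Push the end-of-row marker. -/
abbrev pushEnd (k : Reg) : StackOp Sym Mode := .push (some k) fun _ => none

/-- Remove the top symbol. -/
abbrev drop (k : Reg) : StackOp Sym Mode := .pop (some k) fun v _ => v

/-- While the top symbol of the stack `k` satisfies `p`, run `P`. -/
abbrev whileTop (k : Reg) (p : Mode → Bool) (P : Prog) : Prog := loop (some k) Mode.read p P

/-- Move symbols from `a` to `b` as long as they satisfy `p`. -/
def transfer (a b : Reg) (p : Option (Option Bool) → Bool) : Prog :=
  whileTop a (fun v => p v.x) (exec [drop a, pushX b])

/-- The word of a row. -/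
def blk (r : List Bool) : List (Option Bool) := r.map some ++ [none]

/-- The word of a list of rows. -/
def blks (L : List (List Bool)) : List (Option Bool) := L.flatMap blk

@[simp] theorem blks_nil : blks [] = [] := rfl
@[simp] theorem blks_cons (r : List Bool) (L : List (List Bool)) :
    blks (r :: L) = blk r ++ blks L := rfl
@[simp] theorem blks_append (L L' : List (List Bool)) : blks (L ++ L') = blks L ++ blks L' := by
  simp [blks]
@[simp] theorem blk_length (r : List Bool) : (blk r).length = r.length + 1 := by simp [blk]

theorem blks_length_le {n : ℕ} {L : List (List Bool)} (h : ∀ r ∈ L, r.length ≤ n) :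
    (blks L).length ≤ L.length * (n + 1) := by
  induction L with
  | nil => simp
  | cons r L ih =>
    simp only [List.mem_cons, forall_eq_or_imp] at h
    have := ih h.2
    simp only [blks_cons, List.length_append, blk_length, List.length_cons]
    nlinarith [h.1]

theorem runs_exec_of {ops : List (StackOp Sym Mode)} {c c' : Mode × (∀ k, List (Sym k))}
    (h : ops.foldl (fun c op => op.run c) c = c') : (exec ops).Runs c c' 1 :=
  h ▸ runs_exec ops c

theorem runs_whileTop_done {k : Reg} {p : Mode → Bool} {P : Prog} {v : Mode}
    {S : ∀ k, List (Sym k)} {h : Option (Option Bool)} (hk : (S (some k)).head? = h)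
    (hp : p (v.read h) = false) : (whileTop k p P).Runs (v, S) (v.read h, S) 1 := by
  subst hk
  exact Runs.loop_done (c := (v, S)) hp

theorem runs_whileTop_step {k : Reg} {p : Mode → Bool} {P : Prog} {v : Mode}
    {S : ∀ k, List (Sym k)} {c' c'' : Mode × (∀ k, List (Sym k))} {s t : ℕ}
    (h : Option (Option Bool)) (hk : (S (some k)).head? = h) (hp : p (v.read h) = true)
    (hP : P.Runs (v.read h, S) c' s) (hl : (whileTop k p P).Runs c' c'' t) :
    (whileTop k p P).Runs (v, S) c'' (s + 1 + t) := by
  subst hk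
  exact Runs.loop_step (c := (v, S)) hp hP hl

/-- Moving symbols one at a time reverses them. Each symbol costs one test and one block, and the
last test fails at `rest`. -/
theorem runs_transfer {a b : Reg} (hab : a ≠ b) {p : Option (Option Bool) → Bool} (v : Mode)
    {S S' : ∀ k, List (Sym k)} (l rest : List (Option Bool)) (hS : S (some a) = l ++ rest)
    (hl : ∀ s ∈ l, p (some s) = true) (hr : p rest.head? = false)
    (hS' : Function.update (Function.update S (some a) rest) (some b)
      (l.reverse ++ S (some b)) = S') :
    (transfer a b p).Runs (v, S) (v.read rest.head?, S') (2 * l.length + 1) := by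
  subst hS'
  induction l generalizing v S with
  | nil =>
    have hS : S (some a) = rest := hS
    subst hS
    simpa [transfer] using runs_whileTop_done (p := fun v => p v.x) (P := exec [drop a, pushX b])
      (v := v) (S := S) rfl hr
  | cons s l ih =>
    have hba : (some b : Option Reg) ≠ some a := by simpa using hab.symm
    have hab' : (some a : Option Reg) ≠ some b := by simpa using hab
    have hstep := runs_exec_of (ops := [drop a, pushX b]) (c := (v.read (some s), S))
      (c' := (v.read (some s), Function.update (Function.update S (some a) (l ++ rest)) (some b)
        (s :: S (some b)))) (by simp [StackOp.run, hS, hba])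
    have hrec := ih (v.read (some s)) (S := Function.update (Function.update S (some a)
      (l ++ rest)) (some b) (s :: S (some b))) (by simp [hab']) (fun s' h => hl s' (by simp [h]))
    have := runs_whileTop_step (some s) (by simp [hS]) (by simpa using hl s (by simp)) hstep hrec
    have hupd : Function.update (Function.update S (some a) rest) (some b)
        ((s :: l).reverse ++ S (some b)) = Function.update (Function.update (Function.update
        (Function.update S (some a) (l ++ rest)) (some b) (s :: S (some b))) (some a) rest) (some b)
        (l.reverse ++ Function.update (Function.update S (some a) (l ++ rest)) (some b)
          (s :: S (some b)) (some b)) := by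
      funext k
      by_cases hb : k = some b
      · subst hb; simp
      · by_cases ha : k = some a
        · subst ha; simp [hab']
        · simp [ha, hb]
    rw [hupd]
    exact this.mono (by simp only [List.length_cons]; omega)

/-! ### Searching the price table for a cheapest neighbour. -/

/-- Both symbols read last are the bit one. -/
def Mode.both (v : Mode) : Bool := v.x == some (some true) && v.y == some (some true)

/-- Compare the top row of `U` with the top row of `T` until both have a one in the same column;
that entry of the row of `T` is cleared. -/
def scanRow : Prog :=
  whileTop .U (fun v => isBit v.x && !v.hit) <| exec
    [drop .U, .pop (some .T) fun v h => { v with y := h }, pushX .A,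
      .push (some .C) fun v => if v.both then some false else v.y.getD none,
      .load fun v => { v with hit := v.both }]

/-- Run through the rows of `T` until the top row of `U` has a column in common with one. -/
def scanLevels : Prog :=
  whileTop .T (fun v => v.x.isSome && !v.hit) <| seq scanRow <|
    ite Mode.hit (exec []) (seq (exec [drop .T, pushEnd .C]) (transfer .A .U Option.isSome))

/-- No column has a one in both rows. -/
def Miss (z : List (Bool × Bool)) : Prop := ∀ e ∈ z, (e.1 && e.2) = false

variable {w : List Bool} {u t o a b c d : List (Option Bool)}

/-- Written with an arbitrary continuation, so that the hit and the miss share the treatment of the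
columns before the decisive one. Only the flags of `v'` matter later; the symbols it has read are
left unspecified. -/
theorem scanRow_prefix (z : List (Bool × Bool)) (hz : Miss z) (v : Mode) (hv : v.hit = false) :
    ∃ v' : Mode, v'.hit = false ∧ v'.bad = v.bad ∧
      ∀ (c' : Mode × (∀ k, List (Sym k))) (s : ℕ),
        scanRow.Runs (v', mem w u t o ((z.map fun e => some e.1).reverse ++ a) b
          ((z.map fun e => some e.2).reverse ++ c) d) c' s →
        scanRow.Runs (v, mem w ((z.map fun e => some e.1) ++ u) ((z.map fun e => some e.2) ++ t)
          o a b c d) c' (2 * z.length + s) := by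
  induction z generalizing v a c with
  | nil => exact ⟨v, hv, rfl, fun c' s h => by simpa using h⟩
  | cons e z ih =>
    have he : (e.1 && e.2) = false := hz e (by simp)
    have hstep : (exec
        [drop .U, .pop (some .T) fun v h => { v with y := h }, pushX .A,
          .push (some .C) fun v => if v.both then some false else v.y.getD none,
          .load fun v => { v with hit := v.both }]).Runs
        (v.read (some (some e.1)), mem w (((e :: z).map fun e => some e.1) ++ u)
          (((e :: z).map fun e => some e.2) ++ t) o a b c d)
        (⟨some (some e.1), some (some e.2), false, v.bad⟩,
          mem w ((z.map fun e => some e.1) ++ u)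
            ((z.map fun e => some e.2) ++ t) o (some e.1 :: a) b (some e.2 :: c) d) 1 := by
      refine runs_exec_of ?_
      rcases e with ⟨_ | _, _ | _⟩ <;> simp [StackOp.run, Mode.both, Mode.read] at he ⊢
    obtain ⟨v', h1, h2, h3⟩ := ih (fun e' he' => hz e' (by simp [he'])) (a := some e.1 :: a)
      (c := some e.2 :: c) (⟨some (some e.1), some (some e.2), false, v.bad⟩) rfl
    refine ⟨v', h1, h2, fun c' s h => ?_⟩
    have hrec := h3 c' s (by simpa using h)
    exact (runs_whileTop_step _ rfl (by simp [hv]) hstep hrec).mono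
      (by simp only [List.length_cons]; omega)

theorem scanRow_miss (z : List (Bool × Bool)) (hz : Miss z) (v : Mode) (hv : v.hit = false) :
    ∃ v' : Mode, v'.hit = false ∧ v'.bad = v.bad ∧
      scanRow.Runs (v, mem w ((z.map fun e => some e.1) ++ none :: u)
          ((z.map fun e => some e.2) ++ t) o a b c d)
        (v', mem w (none :: u) t o ((z.map fun e => some e.1).reverse ++ a) b
          ((z.map fun e => some e.2).reverse ++ c) d) (2 * z.length + 1) := by
  obtain ⟨v', h1, h2, h3⟩ := scanRow_prefix z hz v hv
  exact ⟨v'.read (some none), h1, h2, h3 _ _ (runs_whileTop_done rfl (by simp))⟩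

theorem scanRow_hit (z : List (Bool × Bool)) (hz : Miss z) (v : Mode) (hv : v.hit = false) :
    ∃ v' : Mode, v'.hit = true ∧ v'.bad = v.bad ∧
      scanRow.Runs (v, mem w ((z.map fun e => some e.1) ++ some true :: u)
          ((z.map fun e => some e.2) ++ some true :: t) o a b c d)
        (v', mem w u t o (some true :: ((z.map fun e => some e.1).reverse ++ a)) b
          (some false :: ((z.map fun e => some e.2).reverse ++ c)) d) (2 * z.length + 3) := by
  obtain ⟨v', h1, h2, h3⟩ := scanRow_prefix z hz v hv
  have hstep := runs_exec_of (ops := [drop .U, .pop (some .T) fun v h => { v with y := h },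
      pushX .A, .push (some .C) fun v => if v.both then some false else v.y.getD none,
      .load fun v => { v with hit := v.both }])
    (c := (v'.read (some (some true)), mem w (some true :: u) (some true :: t) o
      ((z.map fun e => some e.1).reverse ++ a) b ((z.map fun e => some e.2).reverse ++ c) d))
    (c' := (⟨some (some true), some (some true), true, v'.bad⟩,
      mem w u t o (some true :: ((z.map fun e => some e.1).reverse ++ a)) b
        (some false :: ((z.map fun e => some e.2).reverse ++ c)) d))
    (by simp [StackOp.run, Mode.both, Mode.read])
  exact ⟨(⟨some (some true), some (some true), true, v'.bad⟩ : Mode).read u.head?, rfl, h2,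
    h3 _ 3 (runs_whileTop_step (some (some true)) rfl (by simp [h1]) hstep
      (runs_whileTop_done rfl (by simp)))⟩

theorem transfer_AU (l : List (Option Bool)) (v : Mode) :
    (transfer .A .U Option.isSome).Runs (v, mem w u t o l b c d)
      (v.read none, mem w (l.reverse ++ u) t o [] b c d) (2 * l.length + 1) :=
  runs_transfer (by decide) v l [] (by simp) (by simp) rfl (by simp)

/-- A level without a common column goes to `C`, and the bidder's row is restored from `A` to `U`
before the next level. The form with a continuation again serves both outcomes. -/
theorem scanLevels_prefix (r : List Bool) (L : List (List Bool))
    (hL : ∀ s ∈ L, s.length = r.length ∧ Miss (r.zip s)) (v : Mode) (hv : v.hit = false) :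
    ∃ v' : Mode, v'.hit = false ∧ v'.bad = v.bad ∧
      ∀ (c' : Mode × (∀ k, List (Sym k))) (s : ℕ),
        scanLevels.Runs (v', mem w (blk r ++ u) t o [] b ((blks L).reverse ++ c) d) c' s →
        scanLevels.Runs (v, mem w (blk r ++ u) (blks L ++ t) o [] b c d) c'
          (L.length * (4 * r.length + 5) + s) := by
  induction L generalizing v c with
  | nil => exact ⟨v, hv, rfl, fun c' s h => by simpa using h⟩
  | cons q L ih =>
    simp only [List.mem_cons, forall_eq_or_imp] at hL
    have hz1 : (r.zip q).map (fun e => some e.1) = r.map some := by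
      rw [← Function.comp_def, ← List.map_map]
      simp [List.map_fst_zip, hL.1.1]
    have hz2 : (r.zip q).map (fun e => some e.2) = q.map some := by
      rw [← Function.comp_def, ← List.map_map]
      simp [List.map_snd_zip, hL.1.1]
    obtain ⟨v₁, h1, h2, h3⟩ := scanRow_miss (w := w) (u := u) (t := none :: (blks L ++ t)) (o := o)
      (a := []) (b := b) (c := c) (d := d) (r.zip q) hL.1.2 (v.read (blks (q :: L) ++ t).head?) hv
    rw [hz1, hz2] at h3
    have h4 := runs_exec_of (ops := [drop .T, pushEnd .C])
      (c := (v₁, mem w (none :: u) (none :: (blks L ++ t)) o ((r.map some).reverse ++ []) b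
        ((q.map some).reverse ++ c) d))
      (c' := (v₁, mem w (none :: u) (blks L ++ t) o (r.map some).reverse b
        ((blk q).reverse ++ c) d)) (by simp [StackOp.run, blk])
    have h5 := h4.seq (transfer_AU _ v₁)
    obtain ⟨v', h6, h7, h8⟩ := ih hL.2 (v₁.read none) h1 (c := (blk q).reverse ++ c)
    refine ⟨v', h6, h7.trans h2, fun c' s h => ?_⟩
    have h9 := h8 c' s (by simpa using h)
    refine (runs_whileTop_step (blks (q :: L) ++ t).head? rfl ?_
      (c' := (v₁.read none, mem w (blk r ++ u) (blks L ++ t) o [] b ((blk q).reverse ++ c) d))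
      (Runs.seq (by simpa [blk] using h3) (Runs.ite_false h1 (by simpa [blk] using h5))) h9).mono ?_
    · cases q <;> simp [blk, hv]
    · simp [hL.1.1]
      ring_nf
      omega

theorem isBit_of_mem_map {r : List Bool} {s : Option Bool} (h : s ∈ r.map some) :
    isBit (some s) = true := by
  obtain ⟨b, -, rfl⟩ := List.mem_map.1 h
  rfl

theorem scanLevels_miss (r : List Bool) (L : List (List Bool))
    (hL : ∀ s ∈ L, s.length = r.length ∧ Miss (r.zip s)) (v : Mode) (hv : v.hit = false) :
    ∃ v' : Mode, v'.hit = false ∧ v'.bad = v.bad ∧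
      scanLevels.Runs (v, mem w (blk r ++ u) (blks L) o [] b [] d)
        (v', mem w (blk r ++ u) [] o [] b (blks L).reverse d) (L.length * (4 * r.length + 5) + 1) := by
  obtain ⟨v', h1, h2, h3⟩ := scanLevels_prefix (w := w) (u := u) (t := []) (o := o) (b := b)
    (c := []) (d := d) r L hL v hv
  exact ⟨v'.read none, h1, h2, by
    simpa using h3 _ _ (runs_whileTop_done (h := none) rfl (by simp))⟩

/-- The search stops in the middle of both rows. The number of symbols below the top of `A` is the
index of the column found, and the bit on top of `C` is already cleared, which is the price rise. -/
theorem scanLevels_hit (r₁ r₂ s₁ s₂ : List Bool) (hrs : s₁.length = r₁.length)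
    (hz : Miss (r₁.zip s₁)) (L : List (List Bool))
    (hL : ∀ s ∈ L, s.length = (r₁ ++ true :: r₂).length ∧ Miss ((r₁ ++ true :: r₂).zip s))
    (v : Mode) (hv : v.hit = false) :
    ∃ v' : Mode, v'.hit = true ∧ v'.bad = v.bad ∧
      scanLevels.Runs (v, mem w (blk (r₁ ++ true :: r₂) ++ u)
          (blks L ++ (blk (s₁ ++ true :: s₂) ++ t)) o [] b [] d)
        (v', mem w (blk r₂ ++ u) (blk s₂ ++ t) o (some true :: (r₁.map some).reverse) b
          (some false :: ((s₁.map some).reverse ++ (blks L).reverse)) d)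
        (L.length * (4 * (r₁ ++ true :: r₂).length + 5) + (2 * r₁.length + 7)) := by
  obtain ⟨v₁, h1, h2, h3⟩ := scanLevels_prefix (w := w) (u := u)
    (t := blk (s₁ ++ true :: s₂) ++ t) (o := o) (b := b) (c := []) (d := d) _ L hL v hv
  have hz1 : (r₁.zip s₁).map (fun e => some e.1) = r₁.map some := by
    rw [← Function.comp_def, ← List.map_map]
    simp [List.map_fst_zip, hrs]
  have hz2 : (r₁.zip s₁).map (fun e => some e.2) = s₁.map some := by
    rw [← Function.comp_def, ← List.map_map]
    simp [List.map_snd_zip, hrs]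
  obtain ⟨v₂, h4, h5, h6⟩ := scanRow_hit (w := w) (u := blk r₂ ++ u) (t := blk s₂ ++ t) (o := o)
    (a := []) (b := b) (c := (blks L).reverse) (d := d) _ hz
    (v₁.read (blk (s₁ ++ true :: s₂) ++ t).head?) h1
  rw [hz1, hz2] at h6
  have h7 := Runs.seq h6 (Runs.ite_true (P := exec [])
    (Q := seq (exec [drop .T, pushEnd .C]) (transfer .A .U Option.isSome)) h4 (runs_exec [] _))
  refine ⟨v₂.read (blk s₂ ++ t).head?, h4, h5.trans h2, ?_⟩
  have h8 := h3 _ _ (runs_whileTop_step (blk (s₁ ++ true :: s₂) ++ t).head? (by simp)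
    (by cases s₁ <;> simp [blk, h1]) (by simpa [blk] using h7)
    (runs_whileTop_done (h := (blk s₂ ++ t).head?) (by simp [blk]) (by simp [h4])))
  refine (by simpa [blk] using h8 : Runs _ _ _ _).mono ?_
  simp [hrs]

/-! ### Replacing the owner of a column. -/

/-- For every symbol on `A` move it to `U` and one row from `O` to `D`. -/
def skipRows : Prog :=
  whileTop .A (fun v => v.x.isSome) <| seq (exec [drop .A, pushX .U]) <|
    seq (transfer .O .D isBit) (exec [drop .O, pushEnd .D])

theorem runs_skipRows (n : ℕ) (l : List (Option Bool)) (L : List (List Bool))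
    (hlL : L.length = l.length) (hL : ∀ s ∈ L, s.length ≤ n) (v : Mode) :
    skipRows.Runs (v, mem w u t (blks L ++ o) l b c d)
      (v.read none, mem w (l.reverse ++ u) t o [] b c ((blks L).reverse ++ d))
      (L.length * (2 * n + 4) + 1) := by
  induction L generalizing l v u d with
  | nil =>
    obtain rfl : l = [] := by simpa using hlL.symm
    simpa [skipRows] using runs_whileTop_done (h := none) rfl (by simp)
  | cons q L ih =>
    obtain ⟨s, l, rfl⟩ : ∃ s l', l = s :: l' := by
      cases l with
      | nil => simp at hlL
      | cons s l => exact ⟨s, l, rfl⟩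
    simp only [List.length_cons, Nat.add_right_cancel_iff] at hlL
    simp only [List.mem_cons, forall_eq_or_imp] at hL
    have h1 := runs_exec_of (ops := [drop .A, pushX .U])
      (c := (v.read (some s), mem w u t (blks (q :: L) ++ o) (s :: l) b c d))
      (c' := (v.read (some s), mem w (s :: u) t (blks (q :: L) ++ o) l b c d))
      (by simp [StackOp.run])
    have h2 := runs_transfer (a := .O) (b := .D) (by decide) (p := isBit) (v.read (some s))
      (S := mem w (s :: u) t (blks (q :: L) ++ o) l b c d)
      (S' := mem w (s :: u) t (none :: (blks L ++ o)) l b c ((q.map some).reverse ++ d))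
      (q.map some) (none :: (blks L ++ o)) (by simp [blk]) (fun _ => isBit_of_mem_map) (by simp) (by simp)
    have h3 := runs_exec_of (ops := [drop .O, pushEnd .D])
      (c := ((v.read (some s)).read (some none),
        mem w (s :: u) t (none :: (blks L ++ o)) l b c ((q.map some).reverse ++ d)))
      (c' := (v.read (some none),
        mem w (s :: u) t (blks L ++ o) l b c ((blk q).reverse ++ d)))
      (by simp [StackOp.run, blk])
    have h4 := ih (u := s :: u) (d := (blk q).reverse ++ d) l hlL hL.2 (v.read (some none))
    have h5 := runs_whileTop_step (some s) (by simp) (by simp) (h1.seq (h2.seq h3)) h4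
    refine (by simpa [skipRows] using h5 : Runs _ _ _ _).mono ?_
    simp only [List.length_cons]
    nlinarith [hL.1]

/-- Push the row on `B`, if there is one, to `U`. -/
def unload : Prog :=
  whileTop .B (fun v => v.x.isSome) (seq (exec [pushEnd .U]) (transfer .B .U Option.isSome))

/-- The word of a row, or nothing if the row is empty. -/
def kick (q : List Bool) : List (Option Bool) := if q = [] then [] else blk q

/-- The loop serves as a test for emptiness: its body empties `B`, so it runs at most once. -/
theorem runs_unload (q : List Bool) (v : Mode) :
    ∃ v' : Mode, v'.bad = v.bad ∧
      unload.Runs (v, mem w u t o a (q.map some).reverse c d)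
        (v', mem w (kick q ++ u) t o a [] c d) (2 * q.length + 4) := by
  rcases eq_or_ne q [] with rfl | hq
  · exact ⟨v.read none, rfl, (runs_whileTop_done (h := none) (by simp) (by simp)).mono (by simp)⟩
  · refine ⟨v.read none, rfl, ?_⟩
    obtain ⟨s, hs⟩ : ∃ s, ((q.map some).reverse).head? = some s := by
      rw [← Option.isSome_iff_exists]; simpa using hq
    have h1 := runs_exec_of (ops := [pushEnd .U])
      (c := (v.read (some s), mem w u t o a (q.map some).reverse c d))
      (c' := (v.read (some s), mem w (none :: u) t o a (q.map some).reverse c d))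
      (by simp [StackOp.run])
    have h2 := runs_transfer (a := .B) (b := .U) (by decide) (p := Option.isSome) (v.read (some s))
      (S := mem w (none :: u) t o a (q.map some).reverse c d)
      (S' := mem w (kick q ++ u) t o a [] c d)
      (q.map some).reverse [] (by simp) (by simp) (by simp) (by simp [kick, hq, blk])
    exact (runs_whileTop_step (some s) (by simp [← hs]) (by simp) (h1.seq h2)
      (runs_whileTop_done (h := none) (by simp) (by simp))).mono (by simp; omega)

/-- Give the column that has been found to the top row of `U`, and move the previous owner of the
column to `U`. -/
def place : Prog :=
  seq (exec [.pop (some .A) Mode.read, pushX .U]) <| seq skipRows <|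
  seq (transfer .U .A isBit) <| seq (exec [drop .U]) <| seq (transfer .O .B isBit) <|
  seq (transfer .A .O Option.isSome) <| seq unload <|
  seq (transfer .D .O Option.isSome) (transfer .C .T Option.isSome)

/-- Returning the `r₁.length` bits before the found column to `U` skips equally many owners, which
leads to the owner `q` of that column. The end marker of `q` stays on `O` and becomes the end marker
of the new owner's row. -/
theorem runs_place (n : ℕ) (r₁ r₂ : List Bool) (L : List (List Bool)) (q : List Bool)
    (hlL : L.length = r₁.length) (hL : ∀ s ∈ L, s.length ≤ n) (v : Mode) :
    ∃ v' : Mode, v'.bad = v.bad ∧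
      place.Runs
        (v, mem w (blk r₂ ++ u) t (blks L ++ (blk q ++ o)) (some true :: (r₁.map some).reverse)
          [] c [])
        (v', mem w (kick q ++ u) (c.reverse ++ t) (blks L ++ (blk (r₁ ++ true :: r₂) ++ o))
          [] [] [] [])
        (L.length * (2 * n + 4) + 2 * (blks L).length + 2 * c.length +
          4 * (r₁ ++ true :: r₂).length + 4 * q.length + 12) := by
  set r := r₁ ++ true :: r₂ with hr
  have h1 := runs_exec_of (ops := [.pop (some .A) Mode.read, pushX .U])
    (c := (v, mem w (blk r₂ ++ u) t (blks L ++ (blk q ++ o)) (some true :: (r₁.map some).reverse)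
      [] c []))
    (c' := (v.read (some (some true)), mem w (some true :: (blk r₂ ++ u)) t
      (blks L ++ (blk q ++ o)) (r₁.map some).reverse [] c []))
    (by simp [StackOp.run])
  have h2 := runs_skipRows (w := w) (u := some true :: (blk r₂ ++ u)) (t := t) (o := blk q ++ o)
    (b := []) (c := c) (d := []) n (r₁.map some).reverse L (by simp [hlL]) hL
    (v.read (some (some true)))
  have hU : (r₁.map some).reverse.reverse ++ some true :: (blk r₂ ++ u) = r.map some ++ none :: u := by
    simp [hr, blk]
  rw [hU] at h2
  have h3 := runs_transfer (a := .U) (b := .A) (by decide) (p := isBit)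
    ((v.read (some (some true))).read none)
    (S := mem w (r.map some ++ none :: u) t (blk q ++ o) [] [] c ((blks L).reverse ++ []))
    (S' := mem w (none :: u) t (blk q ++ o) (r.map some).reverse [] c ((blks L).reverse ++ []))
    (r.map some) (none :: u) (by simp) (fun _ => isBit_of_mem_map) (by simp) (by simp)
  have h4 := runs_exec_of (ops := [drop .U])
    (c := (((v.read (some (some true))).read none).read (none :: u).head?,
      mem w (none :: u) t (blk q ++ o) (r.map some).reverse [] c ((blks L).reverse ++ [])))
    (c' := (v.read (some none),
      mem w u t (blk q ++ o) (r.map some).reverse [] c ((blks L).reverse ++ [])))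
    (by simp [StackOp.run])
  have h5 := runs_transfer (a := .O) (b := .B) (by decide) (p := isBit) (v.read (some none))
    (S := mem w u t (blk q ++ o) (r.map some).reverse [] c ((blks L).reverse ++ []))
    (S' := mem w u t (none :: o) (r.map some).reverse (q.map some).reverse c
      ((blks L).reverse ++ []))
    (q.map some) (none :: o) (by simp [blk]) (fun _ => isBit_of_mem_map) (by simp) (by simp)
  have h6 := runs_transfer (a := .A) (b := .O) (by decide) (p := Option.isSome)
    ((v.read (some none)).read (none :: o).head?)
    (S := mem w u t (none :: o) (r.map some).reverse (q.map some).reverse c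
      ((blks L).reverse ++ []))
    (S' := mem w u t (blk r ++ o) [] (q.map some).reverse c ((blks L).reverse ++ []))
    (r.map some).reverse [] (by simp) (by simp) (by simp) (by simp [blk])
  obtain ⟨v', hv', h7⟩ := runs_unload (w := w) (u := u) (t := t) (o := blk r ++ o) (a := [])
    (c := c) (d := (blks L).reverse ++ []) q
    (((v.read (some none)).read (none :: o).head?).read ([] : List (Option Bool)).head?)
  have h8 := runs_transfer (a := .D) (b := .O) (by decide) (p := Option.isSome) v'
    (S := mem w (kick q ++ u) t (blk r ++ o) [] [] c ((blks L).reverse ++ []))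
    (S' := mem w (kick q ++ u) t (blks L ++ (blk r ++ o)) [] [] c [])
    (blks L).reverse [] (by simp) (by simp) (by simp) (by simp)
  have h9 := runs_transfer (a := .C) (b := .T) (by decide) (p := Option.isSome)
    (v'.read ([] : List (Option Bool)).head?)
    (S := mem w (kick q ++ u) t (blks L ++ (blk r ++ o)) [] [] c [])
    (S' := mem w (kick q ++ u) (c.reverse ++ t) (blks L ++ (blk r ++ o)) [] [] [] [])
    c [] (by simp) (by simp) (by simp) (by simp)
  refine ⟨_, ?_, (h1.seq (h2.seq (h3.seq (h4.seq (h5.seq (h6.seq (h7.seq (h8.seq h9)))))))).mono ?_⟩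
  · simpa using hv'
  · simp only [List.length_map, List.length_reverse]
    omega

/-! ### Representation of an auction state on the stacks. -/

open scoped Classical in
/-- The row of the vertex `v` in the adjacency matrix. -/
noncomputable def row {n : ℕ} (G : SimpleGraph (Fin n)) (v : Fin n) : List Bool :=
  List.ofFn fun j => decide (G.Adj v j)

/-- The row of the price table that tells which columns cost at most `r`. -/
def priceRow {n : ℕ} (p : Fin n → ℕ) (r : ℕ) : List Bool := List.ofFn fun j => decide (p j ≤ r)

/-- The price table. -/
def priceTable {n : ℕ} (p : Fin n → ℕ) : List (List Bool) := (List.range n).map (priceRow p)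

/-- The row of the owner of a column; a free column has the empty row. -/
noncomputable def ownerRow {n : ℕ} (G : SimpleGraph (Fin n)) : Option (Fin n) → List Bool
  | none => []
  | some v => row G v

/-- The rows of the owners of all columns. -/
noncomputable def ownerRows {n : ℕ} (G : SimpleGraph (Fin n)) (own : Fin n → Option (Fin n)) :
    List (List Bool) :=
  List.ofFn fun j => ownerRow G (own j)

/-- The stacks that represent the list `Q` of unmatched vertices, the owners and the prices. -/
noncomputable def state {n : ℕ} (G : SimpleGraph (Fin n)) (Q : List (Fin n))
    (own : Fin n → Option (Fin n)) (p : Fin n → ℕ) : ∀ k, List (Sym k) :=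
  mem [] (blks (Q.map (row G))) (blks (priceTable p)) (blks (ownerRows G own)) [] [] [] []

section rows

variable {n : ℕ} (G : SimpleGraph (Fin n)) (own : Fin n → Option (Fin n)) (p : Fin n → ℕ)

@[simp] theorem row_length (v : Fin n) : (row G v).length = n := by simp [row]
@[simp] theorem priceRow_length (r : ℕ) : (priceRow p r).length = n := by simp [priceRow]
@[simp] theorem priceTable_length : (priceTable p).length = n := by simp [priceTable]
@[simp] theorem ownerRows_length : (ownerRows G own).length = n := by simp [ownerRows]

theorem ownerRow_length_le (o : Option (Fin n)) : (ownerRow G o).length ≤ n := by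
  cases o <;> simp [ownerRow]

theorem length_le_of_mem_ownerRows {s : List Bool} (h : s ∈ ownerRows G own) : s.length ≤ n := by
  obtain ⟨j, rfl⟩ := (List.mem_ofFn' _ _).1 h
  exact ownerRow_length_le G _

theorem blks_priceTable_length : (blks (priceTable p)).length ≤ n * (n + 1) :=
  (blks_length_le (n := n) (by simp [priceTable])).trans (by simp)

theorem blks_ownerRows_length : (blks (ownerRows G own)).length ≤ n * (n + 1) :=
  (blks_length_le fun _ => length_le_of_mem_ownerRows G own).trans (by simp)

end rows

theorem take_append_cons_drop {α : Type*} (l : List α) (i : ℕ) (h : i < l.length) :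
    l.take i ++ l[i] :: l.drop (i + 1) = l := by
  rw [List.getElem_cons_drop, List.take_append_drop]

theorem ofFn_update {α : Type*} {n : ℕ} (f : Fin n → α) (j : Fin n) (x : α) :
    List.ofFn (Function.update f j x) =
      (List.ofFn f).take j ++ x :: (List.ofFn f).drop (j + 1) := by
  have h : (List.ofFn f).set j x =
      (List.ofFn f).take j ++ x :: (List.ofFn f).drop (j + 1) := by
    rw [List.set_eq_take_append_cons_drop, if_pos (by simp)]
  rw [← h]
  refine List.ext_getElem (by simp) fun i hi _ => ?_
  simp only [List.getElem_ofFn, List.getElem_set, Function.update_apply, Fin.ext_iff]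
  simp only [eq_comm]

theorem miss_row {n : ℕ} (G : SimpleGraph (Fin n)) (p : Fin n → ℕ) (v : Fin n) (r : ℕ)
    (h : ∀ i, G.Adj v i → r < p i) : Miss ((row G v).zip (priceRow p r)) := by
  intro e he
  obtain ⟨i, hi, rfl⟩ := List.mem_iff_getElem.1 he
  simp only [row, priceRow, List.getElem_zip, List.getElem_ofFn, Bool.and_eq_false_imp,
    decide_eq_true_eq, decide_eq_false_iff_not, not_le]
  exact h _

/-- Restricted to the columns before `j`, because at the decisive level later columns may tie with
`j`. -/
theorem miss_row_take {n : ℕ} (G : SimpleGraph (Fin n)) (p : Fin n → ℕ) (v j : Fin n) (r : ℕ)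
    (h : ∀ i < j, G.Adj v i → r < p i) :
    Miss (((row G v).take j).zip ((priceRow p r).take j)) := by
  intro e he
  obtain ⟨i, hi, rfl⟩ := List.mem_iff_getElem.1 he
  simp only [List.length_zip, List.length_take, row_length, priceRow_length, lt_min_iff] at hi
  simp only [row, priceRow, List.getElem_zip, List.getElem_take, List.getElem_ofFn,
    Bool.and_eq_false_imp, decide_eq_true_eq, decide_eq_false_iff_not, not_le]
  exact h _ (by rw [Fin.lt_def]; exact hi.1.1)

/-! ### Correctness and cost of one bid. -/

/-- One bid: give the first column of least price to the top row of `U`, or fail. -/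
def bid : Prog :=
  seq (exec [.load fun v => { v with hit := false }]) <| seq scanLevels <|
    ite Mode.hit place (exec [.load fun v => { v with bad := true }])

/-- The table has only the levels `r < n`, so a column of price at least `n` has no ones in it and
is never found. -/
theorem runs_bid_miss {n : ℕ} (G : SimpleGraph (Fin n)) (x : Fin n) (Q : List (Fin n))
    (own : Fin n → Option (Fin n)) (p : Fin n → ℕ) (h : ∀ i, G.Adj x i → n ≤ p i) (v : Mode) :
    ∃ v' : Mode, v'.bad = true ∧
      bid.Runs (v, state G (x :: Q) own p)
        (v', mem [] (blks ((x :: Q).map (row G))) [] (blks (ownerRows G own)) [] []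
          (blks (priceTable p)).reverse []) (30 * (n + 1) ^ 2) := by
  have h1 := runs_exec_of (ops := [.load fun v => { v with hit := false }])
    (c := (v, state G (x :: Q) own p)) (c' := ({ v with hit := false }, state G (x :: Q) own p)) rfl
  obtain ⟨v₂, h2, -, h3⟩ := scanLevels_miss (w := []) (u := blks (Q.map (row G)))
    (o := blks (ownerRows G own)) (b := []) (d := []) (row G x) (priceTable p) (by
      intro s hs
      obtain ⟨r, hr, rfl⟩ := List.mem_map.1 hs
      exact ⟨by simp, miss_row G p x r fun i hi => (List.mem_range.1 hr).trans_le (h i hi)⟩)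
    { v with hit := false } rfl
  have h4 := runs_exec_of (ops := [.load fun v => { v with bad := true }])
    (c := (v₂, mem [] (blk (row G x) ++ blks (Q.map (row G))) [] (blks (ownerRows G own)) [] []
      (blks (priceTable p)).reverse [])) rfl
  refine ⟨_, rfl, (h1.seq (h3.seq (Runs.ite_false h2 h4))).mono ?_⟩
  simp only [priceTable_length, row_length]
  nlinarith

theorem runs_bid_hit {n : ℕ} (G : SimpleGraph (Fin n)) (x : Fin n) (Q : List (Fin n))
    (own : Fin n → Option (Fin n)) (p : Fin n → ℕ) (h : ∃ i, G.Adj x i ∧ p i < n) (v : Mode) :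
    ∃ (v' : Mode) (j : Fin n), v'.bad = v.bad ∧ G.Adj x j ∧ p j < n ∧
      (∀ i, G.Adj x i → p j ≤ p i) ∧
      bid.Runs (v, state G (x :: Q) own p)
        (v', state G ((own j).toList ++ Q) (Function.update own j (some x))
          (Function.update p j (p j + 1))) (30 * (n + 1) ^ 2) := by
  classical
  -- As `i < n`, the key `p i * n + i` orders by price and then by index: this is the column that
  -- the scan meets first.
  obtain ⟨j, hj, hmin⟩ := Finset.exists_min_image (Finset.univ.filter fun i => G.Adj x i)
    (fun i => p i * n + i) (by obtain ⟨i, hi, -⟩ := h; exact ⟨i, by simpa using hi⟩)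
  simp only [Finset.mem_filter, Finset.mem_univ, true_and] at hj hmin
  have hle : ∀ i, G.Adj x i → p j ≤ p i := by
    intro i hi
    by_contra! hlt
    have h1 := hmin i hi
    have h2 := i.2
    nlinarith
  have hfirst : ∀ i < j, G.Adj x i → p j < p i := by
    intro i hij hi
    refine lt_of_le_of_ne (hle i hi) fun he => ?_
    have h1 := hmin i hi
    rw [he] at h1
    have : (i : ℕ) < j := hij
    omega
  have hjn : p j < n := by
    obtain ⟨i, hi, hin⟩ := h
    exact (hle i hi).trans_lt hin
  set p' := Function.update p j (p j + 1) with hp'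
  have hrow : row G x = (row G x).take j ++ true :: (row G x).drop (j + 1) := by
    have := take_append_cons_drop (row G x) j (by simp)
    rw [show (row G x)[(j : ℕ)]'(by simp) = true by simp [row, hj]] at this
    exact this.symm
  have hprice : priceRow p (p j) =
      (priceRow p (p j)).take j ++ true :: (priceRow p (p j)).drop (j + 1) := by
    have := take_append_cons_drop (priceRow p (p j)) j (by simp)
    rw [show (priceRow p (p j))[(j : ℕ)]'(by simp) = true by simp [priceRow]] at this
    exact this.symm
  -- Raising the price of `j` from `p j` to `p j + 1` changes only the bit of `j` at level `p j`.
  have hprice' : priceRow p' (p j) =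
      (priceRow p (p j)).take j ++ false :: (priceRow p (p j)).drop (j + 1) := by
    rw [priceRow, priceRow, ← ofFn_update]
    congr 1
    funext i
    by_cases hi : i = j
    · subst hi; simp [hp']
    · simp [hp', hi]
  have hother : ∀ r, r ≠ p j → priceRow p' r = priceRow p r := by
    intro r hr
    rw [priceRow, priceRow]
    congr 1
    funext i
    by_cases hi : i = j
    · subst hi
      simp only [hp', Function.update_self, decide_eq_decide]
      omega
    · simp [hp', hi]
  have hrange : List.range n =
      List.range (p j) ++ p j :: (List.range n).drop (p j + 1) := by
    have := take_append_cons_drop (List.range n) (p j) (by simpa using hjn)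
    rw [List.take_range, List.getElem_range, min_eq_left hjn.le] at this
    exact this.symm
  set T₁ := (List.range (p j)).map (priceRow p) with hT₁
  set T₂ := ((List.range n).drop (p j + 1)).map (priceRow p) with hT₂
  have htable : priceTable p = T₁ ++ priceRow p (p j) :: T₂ := by
    rw [priceTable, hrange, List.map_append, List.map_cons]
  have htable' : priceTable p' = T₁ ++ priceRow p' (p j) :: T₂ := by
    rw [priceTable, hrange, List.map_append, List.map_cons, hT₁, hT₂]
    congr 1
    · exact List.map_congr_left fun r hr => hother r (by simp at hr; omega)
    · congr 1
      refine List.map_congr_left fun r hr => hother r ?_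
      obtain ⟨i, hi, rfl⟩ := List.mem_iff_getElem.1 hr
      simp
      omega
  have hown : ownerRows G own = (ownerRows G own).take j ++
      ownerRow G (own j) :: (ownerRows G own).drop (j + 1) := by
    have := take_append_cons_drop (ownerRows G own) j (by simp)
    rw [show (ownerRows G own)[(j : ℕ)]'(by simp) = ownerRow G (own j) by simp [ownerRows]] at this
    exact this.symm
  have hown' : ownerRows G (Function.update own j (some x)) = (ownerRows G own).take j ++
      row G x :: (ownerRows G own).drop (j + 1) := by
    rw [ownerRows, ownerRows, ← ofFn_update]
    congr 1
    funext i
    by_cases hi : i = j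
    · subst hi; simp [ownerRow]
    · simp [hi]
  have hkick : kick (ownerRow G (own j)) ++ blks (Q.map (row G)) =
      blks (((own j).toList ++ Q).map (row G)) := by
    cases hoj : own j with
    | none => simp [ownerRow, kick]
    | some y =>
      -- The empty row can stand for a free column because genuine rows have length `n > 0`.
      have : row G y ≠ [] := by
        rw [ne_eq, ← List.length_eq_zero_iff, row_length]
        exact (Fin.pos j).ne'
      simp [ownerRow, kick, this]
  set r₁ := (row G x).take j with hr₁
  set r₂ := (row G x).drop (j + 1) with hr₂
  set s₁ := (priceRow p (p j)).take j with hs₁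
  set s₂ := (priceRow p (p j)).drop (j + 1) with hs₂
  set O₁ := (ownerRows G own).take j with hO₁
  set O₂ := (ownerRows G own).drop (j + 1) with hO₂
  have hO₁n : ∀ s ∈ O₁, s.length ≤ n := fun s hs =>
    length_le_of_mem_ownerRows G own (List.mem_of_mem_take hs)
  have h1 := runs_exec_of (ops := [.load fun v => { v with hit := false }])
    (c := (v, state G (x :: Q) own p)) (c' := ({ v with hit := false }, state G (x :: Q) own p)) rfl
  obtain ⟨v₂, h2, h3, h4⟩ := scanLevels_hit (w := []) (u := blks (Q.map (row G)))
    (t := blks T₂) (o := blks (ownerRows G own)) (b := []) (d := []) r₁ r₂ s₁ s₂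
    (by simp [hr₁, hs₁]) (miss_row_take G p x j _ hfirst) T₁ (by
      intro s hs
      obtain ⟨r, hr, rfl⟩ := List.mem_map.1 hs
      rw [← hrow]
      exact ⟨by simp, miss_row G p x r fun i hi => (List.mem_range.1 hr).trans_le (hle i hi)⟩)
    { v with hit := false } rfl
  obtain ⟨v₃, h5, h6⟩ := runs_place (w := []) (u := blks (Q.map (row G))) (t := blk s₂ ++ blks T₂)
    (o := blks O₂) (c := some false :: ((s₁.map some).reverse ++ (blks T₁).reverse)) n r₁ r₂ O₁
    (ownerRow G (own j)) (by simp [hr₁, hO₁]) hO₁n v₂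
  have hstart : state G (x :: Q) own p = mem [] (blk (r₁ ++ true :: r₂) ++ blks (Q.map (row G)))
      (blks T₁ ++ (blk (s₁ ++ true :: s₂) ++ blks T₂)) (blks (ownerRows G own)) [] [] [] [] := by
    rw [state, htable, ← hprice, ← hrow]
    simp
  have hend : state G ((own j).toList ++ Q) (Function.update own j (some x)) p' =
      mem [] (kick (ownerRow G (own j)) ++ blks (Q.map (row G)))
        ((some false :: ((s₁.map some).reverse ++ (blks T₁).reverse)).reverse ++
          (blk s₂ ++ blks T₂))
        (blks O₁ ++ (blk (r₁ ++ true :: r₂) ++ blks O₂)) [] [] [] [] := by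
    rw [state, hkick, htable', hprice', hown', ← hrow]
    simp [blk]
  rw [hstart] at h1 ⊢
  have hmid : blks (ownerRows G own) = blks O₁ ++ (blk (ownerRow G (own j)) ++ blks O₂) := by
    conv_lhs => rw [hown]
    simp
  rw [← hmid] at h6
  refine ⟨v₃, j, h5.trans h3, hj, hjn, hle, ?_⟩
  rw [← hp', hend]
  refine (h1.seq (h4.seq (Runs.ite_true h2 h6))).mono ?_
  have e1 : (r₁ ++ true :: r₂).length = n := by rw [← hrow, row_length]
  have e2 : T₁.length ≤ n := by simpa [hT₁] using hjn.le
  have e3 : r₁.length ≤ n := by simp [hr₁]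
  have e4 : O₁.length ≤ n := by simp [hO₁]
  have e5 : (blks O₁).length ≤ n * (n + 1) :=
    (blks_length_le hO₁n).trans (Nat.mul_le_mul_right _ e4)
  have e6 : (blks T₁).length ≤ n * (n + 1) :=
    (blks_length_le (n := n) (by simp [hT₁])).trans (Nat.mul_le_mul_right _ e2)
  have e7 : s₁.length ≤ n := by simp [hs₁]
  have e8 := ownerRow_length_le G (own j)
  rw [e1]
  simp only [List.length_cons, List.length_append, List.length_reverse, List.length_map]
  have e9 : T₁.length * (4 * n + 5) ≤ n * (4 * n + 5) := Nat.mul_le_mul_right _ e2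
  have e10 : O₁.length * (2 * n + 4) ≤ n * (2 * n + 4) := Nat.mul_le_mul_right _ e4
  nlinarith

/-! ### The auction: invariant, certificate of failure and termination. -/

/-- The invariant of the auction: `Q` lists the vertices that own no column, the price of a column
is zero iff it is free, and the price an owner has paid exceeds the price of each other column that
it could own by at most one. -/
structure Fair {n : ℕ} (G : SimpleGraph (Fin n)) (Q : List (Fin n))
    (own : Fin n → Option (Fin n)) (p : Fin n → ℕ) : Prop where
  nodup : Q.Nodup
  mem_iff : ∀ v, v ∈ Q ↔ ∀ j, own j ≠ some v
  inj : ∀ i j v, own i = some v → own j = some v → i = j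
  free : ∀ j, own j = none ↔ p j = 0
  adj : ∀ j v, own j = some v → G.Adj v j
  near : ∀ j v, own j = some v → ∀ i, G.Adj v i → p j ≤ p i + 1
  le : ∀ j, p j ≤ n

variable {n : ℕ} {G : SimpleGraph (Fin n)} {Q : List (Fin n)} {own : Fin n → Option (Fin n)}
  {p : Fin n → ℕ} {x : Fin n}

theorem fair_init (G : SimpleGraph (Fin n)) :
    Fair G (List.finRange n) (fun _ => none) (fun _ => 0) where
  nodup := List.nodup_finRange n
  mem_iff := by simp
  inj := by simp
  free := by simp
  adj := by simp
  near := by simp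
  le := by simp

/-- The bidder takes a cheapest neighbour, so after the rise it overpays by at most one. For all
other owners the inequality `near` survives because prices never fall. -/
theorem Fair.step (h : Fair G (x :: Q) own p) {j : Fin n} (hj : G.Adj x j) (hjn : p j < n)
    (hmin : ∀ i, G.Adj x i → p j ≤ p i) :
    Fair G ((own j).toList ++ Q) (Function.update own j (some x))
      (Function.update p j (p j + 1)) := by
  have hx : ∀ i, own i ≠ some x := (h.mem_iff x).1 (by simp)
  have hQ : ∀ v ∈ Q, ∀ i, own i ≠ some v := fun v hv => (h.mem_iff v).1 (by simp [hv])
  have hxQ : x ∉ Q := (List.nodup_cons.1 h.nodup).1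
  have hp : ∀ i, p i ≤ Function.update p j (p j + 1) i := by
    intro i
    by_cases hi : i = j
    · subst hi; simp
    · simp [hi]
  refine ⟨?_, fun v => ⟨fun hv i hi => ?_, fun hv => ?_⟩, fun i k v hi hk => ?_, fun i => ?_,
    fun i v hi => ?_, fun i v hi k hk => ?_, fun i => ?_⟩
  · cases hoj : own j with
    | none => simpa using (List.nodup_cons.1 h.nodup).2
    | some y =>
      refine List.nodup_cons.2 ⟨fun hy => hQ y hy j hoj, (List.nodup_cons.1 h.nodup).2⟩
  · simp only [List.mem_append, Option.mem_toList] at hv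
    by_cases hij : i = j
    · subst hij
      obtain rfl : x = v := by simpa using hi
      exact hv.elim (hx i) hxQ
    · rw [Function.update_of_ne hij] at hi
      exact hv.elim (fun hv => hij (h.inj _ _ _ hi hv)) fun hv => hQ v hv i hi
  · simp only [List.mem_append, Option.mem_toList]
    by_contra! hcon
    have hxv : x ≠ v := by simpa using hv j
    have : v ∈ x :: Q := by
      refine (h.mem_iff v).2 fun i => ?_
      by_cases hij : i = j
      · subst hij; exact hcon.1
      · simpa [hij] using hv i
    rcases List.mem_cons.1 this with rfl | hvQ
    · exact hxv rfl
    · exact hcon.2 hvQ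
  · by_cases hij : i = j
    · by_cases hkj : k = j
      · rw [hij, hkj]
      · subst hij
        rw [Function.update_of_ne hkj] at hk
        obtain rfl : x = v := by simpa using hi
        exact absurd hk (hx k)
    · rw [Function.update_of_ne hij] at hi
      by_cases hkj : k = j
      · subst hkj
        obtain rfl : x = v := by simpa using hk
        exact absurd hi (hx i)
      · rw [Function.update_of_ne hkj] at hk
        exact h.inj _ _ _ hi hk
  · by_cases hij : i = j
    · subst hij; simp
    · simpa [hij] using h.free i
  · by_cases hij : i = j
    · subst hij
      obtain rfl : x = v := by simpa using hi
      exact hj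
    · rw [Function.update_of_ne hij] at hi
      exact h.adj i v hi
  · by_cases hij : i = j
    · subst hij
      obtain rfl : x = v := by simpa using hi
      simpa using (hmin k hk).trans (hp k)
    · rw [Function.update_of_ne hij] at hi ⊢
      exact (h.near i v hi k hk).trans (Nat.add_le_add_right (hp k) 1)
  · by_cases hij : i = j
    · subst hij; simpa using hjn
    · simpa [hij] using h.le i

theorem Fair.hasNeighborInjection (h : Fair G [] own p) : HasNeighborInjection G := by
  have hex : ∀ v, ∃ j, own j = some v := by
    intro v
    by_contra! hv
    exact List.not_mem_nil ((h.mem_iff v).2 hv)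
  choose f hf using hex
  refine ⟨f, fun v w hvw => ?_, fun v => h.adj _ _ (hf v)⟩
  have h1 := hf v
  rw [hvw, hf w] at h1
  exact (Option.some.inj h1).symm

/-- Given an injection `f`, count the columns of price at least `n - k`. While the threshold is
positive they all have owners. By `near`, `f` sends these owners to columns at most one cheaper, and
`f x` is a further column since `x` owns nothing. So each lowering of the threshold gains a column.
-/
theorem Fair.not_hasNeighborInjection (h : Fair G (x :: Q) own p)
    (hx : ∀ i, G.Adj x i → n ≤ p i) : ¬ HasNeighborInjection G := by
  classical
  rintro ⟨f, hf, hadj⟩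
  have hcard : ∀ k ≤ n, k + 1 ≤ (Finset.univ.filter fun j => n ≤ p j + k).card := by
    intro k
    induction k with
    | zero =>
      intro _
      exact Finset.card_pos.2 ⟨f x, by simpa using hx _ (hadj x)⟩
    | succ k ih =>
      intro hk
      have ih := ih (by omega)
      set L := Finset.univ.filter fun j => n ≤ p j + k with hL
      have hown : ∀ j ∈ L, ∃ v, own j = some v := by
        intro j hj
        rw [← Option.ne_none_iff_exists']
        intro hnone
        have := (h.free j).1 hnone
        simp only [hL, Finset.mem_filter, Finset.mem_univ, true_and] at hj
        omega
      have hx' : ∀ i, own i ≠ some x := (h.mem_iff x).1 (by simp)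
      let g : Fin n → Fin n := fun j => f ((own j).getD x)
      have hg : ∀ j ∈ L, ∀ v, own j = some v → g j = f v := by
        intro j _ v hv
        simp [g, hv]
      have hinj : Set.InjOn g L := by
        intro i hi j hj hij
        obtain ⟨v, hv⟩ := hown i hi
        obtain ⟨w, hw⟩ := hown j hj
        rw [hg i hi v hv, hg j hj w hw] at hij
        rw [← hf hij] at hw
        exact h.inj i j v hv hw
      have hnot : f x ∉ L.image g := by
        intro hmem
        obtain ⟨j, hj, hjx⟩ := Finset.mem_image.1 hmem
        obtain ⟨v, hv⟩ := hown j hj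
        rw [hg j hj v hv] at hjx
        rw [hf hjx] at hv
        exact hx' j hv
      have hsub : insert (f x) (L.image g) ⊆ Finset.univ.filter fun j => n ≤ p j + (k + 1) := by
        intro i hi
        simp only [Finset.mem_filter, Finset.mem_univ, true_and]
        rcases Finset.mem_insert.1 hi with rfl | hi
        · have := hx _ (hadj x)
          omega
        · obtain ⟨j, hj, rfl⟩ := Finset.mem_image.1 hi
          obtain ⟨v, hv⟩ := hown j hj
          rw [hg j hj v hv]
          have h1 := h.near j v hv _ (hadj v)
          simp only [hL, Finset.mem_filter, Finset.mem_univ, true_and] at hj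
          omega
      have := Finset.card_le_card hsub
      rw [Finset.card_insert_of_notMem hnot, Finset.card_image_of_injOn hinj] at this
      omega
  -- At threshold zero this would give `n + 1` columns among `n`.
  have h1 := hcard n le_rfl
  have h2 := Finset.card_le_univ (Finset.univ.filter fun j => n ≤ p j + n)
  rw [Fintype.card_fin] at h2
  omega

/-- Bid until every row owns a column or a bid fails. -/
def auction : Prog := whileTop .U (fun v => v.x.isSome && !v.bad) bid

/-- The potential `∑ j, (n - p j)` drops with every successful bid. The final stack contents matter
only through their lengths, which bound the cost of clearing them. -/
theorem runs_auction (m : ℕ) (h : Fair G Q own p) (hm : ∑ j, (n - p j) = m) (v : Mode)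
    (hv : v.bad = false) :
    ∃ (v' : Mode) (u t o c : List (Option Bool)), (v'.bad = false ↔ HasNeighborInjection G) ∧
      u.length ≤ n * (n + 1) ∧ t.length ≤ n * (n + 1) ∧ o.length ≤ n * (n + 1) ∧
      c.length ≤ n * (n + 1) ∧
      auction.Runs (v, state G Q own p) (v', mem [] u t o [] [] c [])
        ((m + 1) * (30 * (n + 1) ^ 2 + 1) + 1) := by
  induction m using Nat.strong_induction_on generalizing Q own p v with
  | _ m ih =>
  cases Q with
  | nil =>
    refine ⟨v.read none, [], blks (priceTable p), blks (ownerRows G own), [], ?_, by simp,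
      blks_priceTable_length p, blks_ownerRows_length G own, by simp, ?_⟩
    · simp [hv, h.hasNeighborInjection]
    · exact (runs_whileTop_done (h := none) rfl (by simp)).mono (by omega)
  | cons x Q =>
    obtain ⟨s, hs⟩ : ∃ s, (state G (x :: Q) own p (some .U)).head? = some s := by
      rw [← Option.isSome_iff_exists]; simp [state, blk]
    by_cases hx : ∃ i, G.Adj x i ∧ p i < n
    · obtain ⟨v₁, j, h1, h2, h3, h4, h5⟩ := runs_bid_hit G x Q own p hx (v.read (some s))
      have hlt : ∑ i, (n - Function.update p j (p j + 1) i) < m := by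
        rw [← hm]
        refine Finset.sum_lt_sum (fun i _ => ?_) ⟨j, Finset.mem_univ _, by simp; omega⟩
        by_cases hij : i = j
        · subst hij; simp; omega
        · simp [hij]
      obtain ⟨v', u, t, o, c, h6, hu, ht, ho, hc, h7⟩ :=
        ih _ hlt (h.step h2 h3 h4) rfl v₁ (h1.trans hv)
      refine ⟨v', u, t, o, c, h6, hu, ht, ho, hc, ?_⟩
      refine (runs_whileTop_step (some s) hs (by simp [hv]) h5 h7).mono ?_
      have := Nat.mul_le_mul_right (30 * (n + 1) ^ 2 + 1) (Nat.succ_le_of_lt hlt)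
      rw [Nat.succ_eq_add_one] at this
      rw [Nat.add_mul m]
      omega
    · push Not at hx
      obtain ⟨v₁, h1, h2⟩ := runs_bid_miss G x Q own p hx (v.read (some s))
      refine ⟨v₁.read (blks ((x :: Q).map (row G))).head?, blks ((x :: Q).map (row G)), [],
        blks (ownerRows G own), (blks (priceTable p)).reverse, ?_, ?_, by simp,
        blks_ownerRows_length G own, by simpa using blks_priceTable_length p, ?_⟩
      · simp [h1, h.not_hasNeighborInjection hx]
      · refine (blks_length_le (n := n) (by simp)).trans (Nat.mul_le_mul_right _ ?_)
        simpa using h.nodup.length_le_card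
      · refine (runs_whileTop_step (some s) hs (by simp [hv]) h2
          (runs_whileTop_done (h := (blks ((x :: Q).map (row G))).head?) rfl
            (by simp [h1]))).mono ?_
        nlinarith [Nat.zero_le m, Nat.zero_le (m * (30 * (n + 1) ^ 2 + 1))]

/-! ### Initialisation, cleanup and the whole program. -/

/-- Fill the price table and the owners' list according to the input. -/
def fill : Prog :=
  whileTop .A (fun v => v.x.isSome) <|
    seq (exec [drop .A, pushX .U, .push (some .T) fun v => (v.x.getD none).map fun _ => true]) <|
    ite (fun v => v.x == some none) (exec [pushEnd .O]) (exec [])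

theorem runs_fill {w : List Bool} {u t o b c d : List (Option Bool)} (l : List (Option Bool))
    (v : Mode) :
    fill.Runs (v, mem w u t o l b c d) (v.read none, mem w (l.reverse ++ u)
      ((l.map (Option.map fun _ => true)).reverse ++ t) ((l.filter Option.isNone).reverse ++ o)
      [] b c d) (4 * l.length + 1) := by
  induction l generalizing u t o v with
  | nil => exact runs_whileTop_done (h := none) rfl (by simp)
  | cons s l ih =>
    have h1 := runs_exec_of
      (ops := [drop .A, pushX .U, .push (some .T) fun v => (v.x.getD none).map fun _ => true])
      (c := (v.read (some s), mem w u t o (s :: l) b c d))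
      (c' := (v.read (some s), mem w (s :: u) (s.map (fun _ => true) :: t) o l b c d))
      (by simp [StackOp.run])
    have h2 : (ite (fun v => v.x == some none) (exec [pushEnd .O]) (exec []) : Prog).Runs
        (v.read (some s), mem w (s :: u) (s.map (fun _ => true) :: t) o l b c d)
        (v.read (some s), mem w (s :: u) (s.map (fun _ => true) :: t)
          (if s.isNone then s :: o else o) l b c d) 2 := by
      cases s with
      | none => exact Runs.ite_true (by simp) (runs_exec_of (by simp [StackOp.run]))
      | some s => exact Runs.ite_false (by simp) (runs_exec_of (by simp))
    have h3 := ih (u := s :: u) (t := s.map (fun _ => true) :: t)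
      (o := if s.isNone then s :: o else o) (v.read (some s))
    have h4 := runs_whileTop_step (some s) (by simp) (by simp) (h1.seq h2) h3
    rw [show (4 * (s :: l).length + 1) = 1 + 2 + 1 + (4 * l.length + 1) by
      simp only [List.length_cons]; omega]
    cases s <;> simpa [fill] using h4

/-- With all prices zero every table entry is a one, so the table is the input with its bits set to
one; with all columns free, the owners' list is just the `n` end markers. -/
theorem state_init (G : SimpleGraph (Fin n)) :
    state G (List.finRange n) (fun _ => none) (fun _ => 0) =
      mem [] (blks ((List.finRange n).map (row G)))
        ((blks ((List.finRange n).map (row G))).map (Option.map fun _ => true))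
        ((blks ((List.finRange n).map (row G))).filter Option.isNone) [] [] [] [] := by
  have h1 : ∀ L : List (List Bool), (blks L).map (Option.map fun _ => true) =
      blks (L.map (List.map fun _ => true)) := by
    intro L
    induction L with
    | nil => rfl
    | cons q L ih => simp [ih, blk, Function.comp_def]
  have h2 : ∀ L : List (List Bool), (blks L).filter Option.isNone =
      blks (List.replicate L.length []) := by
    intro L
    induction L with
    | nil => rfl
    | cons q L ih =>
      have : (q.map some).filter Option.isNone = [] := by
        rw [List.filter_map]; simp [Function.comp_def]
      simp only [blks_cons, blk, List.append_assoc, List.filter_append, this, ih]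
      simp [blk, List.replicate_succ]
  rw [h1, h2, state]
  congr 2
  · refine List.ext_getElem (by simp) fun i _ _ => ?_
    simp [priceTable, priceRow, row, List.ofFn_const]
  · simp [ownerRows, ownerRow, List.ofFn_const]

/-- Empty a stack. -/
def clear (k : Reg) : Prog := whileTop k (fun v => v.x.isSome) (exec [drop k])

theorem runs_clear (k : Reg) (v : Mode) (l : List (Option Bool)) {S S' : ∀ k, List (Sym k)}
    (hl : S (some k) = l) (hS : Function.update S (some k) [] = S') :
    (clear k).Runs (v, S) (v.read none, S') (2 * l.length + 1) := by
  subst hS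
  induction l generalizing v S with
  | nil =>
    have : Function.update S (some k) [] = S := by rw [← hl, Function.update_eq_self]
    rw [this]
    exact runs_whileTop_done (by simp [hl]) (by simp)
  | cons s l ih =>
    have h1 := runs_exec_of (ops := [drop k]) (c := (v.read (some s), S))
      (c' := (v.read (some s), Function.update S (some k) l)) (by simp [StackOp.run, hl])
    have h2 := ih (S := Function.update S (some k) l) (v.read (some s)) (by simp)
    have h3 := runs_whileTop_step (p := fun v => v.x.isSome) (some s) (by simp [hl]) (by simp) h1 h2
    refine (by simpa [clear] using h3 : Runs _ _ _ _).mono ?_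
    simp only [List.length_cons]
    omega

/-- The program that decides whether the input graph has an injection that maps every vertex to
one of its neighbours. -/
def main : Prog :=
  seq (transfer .U .A Option.isSome) <| seq fill <| seq auction <| seq (clear .U) <|
  seq (clear .T) <| seq (clear .O) <| seq (clear .C) <|
  exec [.push none Mode.bad, .load fun _ => Mode.init]

/-- The potential starts at `n ^ 2` and a bid costs `O(n ^ 2)`, so the total is quadratic in the
input length `n * (n + 1)`. A halting configuration must have its work stacks empty and its internal
state reset, hence the cleanup. -/
theorem runs_main (G : SimpleGraph (Fin n)) (hn : 0 < n) :
    ∃ b : Bool, (b = false ↔ HasNeighborInjection G) ∧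
      main.Runs (Mode.init, mem [] (blks ((List.finRange n).map (row G))) [] [] [] [] [] [])
        (Mode.init, mem [b] [] [] [] [] [] [] [])
        (60 * (n * (n + 1)) ^ 2 + 80 * (n * (n + 1)) + 20) := by
  set W := blks ((List.finRange n).map (row G)) with hW
  have hWlen : W.length ≤ n * (n + 1) := (blks_length_le (n := n) (by simp)).trans (by simp)
  have h1 := runs_transfer (a := .U) (b := .A) (by decide) (p := Option.isSome) Mode.init
    (S := mem [] W [] [] [] [] [] []) (S' := mem [] [] [] [] W.reverse [] [] [])
    W [] (by simp) (by simp) (by simp) (by simp)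
  have h2 := runs_fill (w := []) (u := []) (t := []) (o := []) (b := []) (c := []) (d := [])
    W.reverse (Mode.init.read ([] : List (Option Bool)).head?)
  have hstate : mem [] (W.reverse.reverse ++ [])
      ((W.reverse.map (Option.map fun _ => true)).reverse ++ [])
      ((W.reverse.filter Option.isNone).reverse ++ []) [] [] [] [] =
      state G (List.finRange n) (fun _ => none) (fun _ => 0) := by
    rw [state_init]
    simp [← hW]
  rw [hstate] at h2
  obtain ⟨v, u, t, o, c, hv, hu, ht, ho, hc, h3⟩ := runs_auction (∑ j : Fin n, (n - 0))
    (fair_init G) rfl ((Mode.init.read ([] : List (Option Bool)).head?).read none) rfl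
  have h4 := runs_clear .U v u (S := mem [] u t o [] [] c []) (S' := mem [] [] t o [] [] c [])
    (by simp) (by simp)
  have h5 := runs_clear .T (v.read none) t (S := mem [] [] t o [] [] c [])
    (S' := mem [] [] [] o [] [] c []) (by simp) (by simp)
  have h6 := runs_clear .O ((v.read none).read none) o (S := mem [] [] [] o [] [] c [])
    (S' := mem [] [] [] [] [] [] c []) (by simp) (by simp)
  have h7 := runs_clear .C (((v.read none).read none).read none) c
    (S := mem [] [] [] [] [] [] c []) (S' := mem [] [] [] [] [] [] [] []) (by simp) (by simp)
  have h8 := runs_exec_of (ops := [.push none Mode.bad, .load fun _ => Mode.init])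
    (c := ((((v.read none).read none).read none).read none, mem [] [] [] [] [] [] [] []))
    (c' := (Mode.init, mem [v.bad] [] [] [] [] [] [] [])) (by simp [StackOp.run])
  refine ⟨v.bad, hv,
    (h1.seq (h2.seq (h3.seq (h4.seq (h5.seq (h6.seq (h7.seq h8))))))).mono ?_⟩
  simp only [List.length_reverse, Nat.sub_zero, Finset.sum_const, Finset.card_univ,
    Fintype.card_fin, smul_eq_mul]
  have e1 : n * n ≤ n * (n + 1) := by nlinarith
  -- Here `n ≥ 1` is needed.
  have e2 : (n + 1) ^ 2 ≤ 2 * (n * (n + 1)) := by nlinarith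
  generalize n * (n + 1) = X at *
  have e3 : (n * n + 1) * (30 * (n + 1) ^ 2 + 1) ≤ (X + 1) * (60 * X + 1) :=
    Nat.mul_le_mul (by omega) (by omega)
  nlinarith

open Turing

theorem encodeGraph_eq (G : InputGraph) :
    encodeGraph G = blks ((List.finRange G.1).map (row G.2)) := by
  rw [encodeGraph, blks, List.flatMap_map]
  congr 1
  funext i
  simp [encodeRow, blk, row, List.ofFn_eq_map, Function.comp_def]

/-- The machine that decides the existence of an injection into neighbours. -/
def machine : FinTM2 := main.toFinTM2 (some .U) none Mode.init

open scoped Classical in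
theorem computableInPolyTime :
    Nonempty (TM2ComputableInPolyTime encodeGraph Computability.encodeBool
      fun G => decide (¬ HasNeighborInjection G.2)) := by
  refine ⟨{
    tm := machine
    inputAlphabet := Equiv.refl (Option Bool)
    outputAlphabet := Equiv.refl Bool
    time := 60 * Polynomial.X ^ 2 + 80 * Polynomial.X + 21
    outputsFun := fun G => Classical.choice ?_ }⟩
  obtain ⟨b, hb, hrun⟩ := runs_main G.2 G.1.pos
  have hbt : decide (¬ HasNeighborInjection G.2) = b := by
    cases b <;> simp_all
  have hstart : initList machine (List.map (Equiv.refl (Option Bool)).invFun (encodeGraph G)) =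
      (⟨some (some main.entry), Mode.init,
        mem [] (blks ((List.finRange G.1).map (row G.2))) [] [] [] [] [] []⟩ :
        TM2.Cfg Sym (Option main.Lab) Mode) := by
    rw [← encodeGraph_eq]
    have hid : List.map (Equiv.refl (Option Bool)).invFun (encodeGraph G) = encodeGraph G :=
      List.map_id _
    refine (congrArg (initList machine) hid).trans
      (congrArg (TM2.Cfg.mk (some (some main.entry)) Mode.init) ?_)
    funext k
    rcases k with _ | _ | _ <;> rfl
  have hend : haltList machine
      (List.map (Equiv.refl Bool).invFun (Computability.encodeBool b)) =
      (⟨none, Mode.init, mem [b] [] [] [] [] [] [] []⟩ :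
        TM2.Cfg Sym (Option main.Lab) Mode) := by
    refine congrArg (TM2.Cfg.mk none Mode.init) ?_
    funext k
    rcases k with _ | _ | _ <;> rfl
  have htime : (60 * Polynomial.X ^ 2 + 80 * Polynomial.X + 21 : Polynomial ℕ).eval
      (encodeGraph G).length = 60 * (G.1 * (G.1 + 1)) ^ 2 + 80 * (G.1 * (G.1 + 1)) + 20 + 1 := by
    simp [encodeGraph_length]
  rw [TM2OutputsInTime, hbt, hstart, Option.map_some, hend, htime]
  exact hrun.evalsTo

end HallMachine

/-! ### The dichotomy and its decision procedure. -/

theorem mainTheorem10 :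
    (∀ G : InputGraph, Tendsto (powerRatio G.2) atTop (𝓝 (ultimateRatio G.2))) ∧
    ∃ test : InputGraph → Bool,
      Nonempty
        (Turing.TM2ComputableInPolyTime encodeGraph Computability.encodeBool test) ∧
      ∀ G : InputGraph,
        (test G = true ↔ ultimateRatio G.2 = 1) ∧
        (test G = false ↔ ultimateRatio G.2 ≤ 1 / 2) ∧
        (test G = false ↔ HallConditionDouble G.2) := by
  classical
  have hne : ∀ G : InputGraph, Nonempty (Fin G.1) := fun G => ⟨⟨0, G.1.pos⟩⟩
  refine ⟨fun G => have := hne G; tendsto_powerRatio,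
    fun G => decide (¬ HasNeighborInjection G.2), ?_, fun G => ?_⟩
  · convert! HallMachine.computableInPolyTime
  have := hne G
  rw [hallConditionDouble_iff_hasNeighborInjection]
  -- Since the values 1 and at most 1/2 exclude each other, one implication in each case gives all
  -- the equivalences.
  by_cases h : HasNeighborInjection G.2
  · have h2 := h.ultimateRatio_le
    have h1 : ultimateRatio G.2 ≠ 1 := fun h1 => by rw [h1] at h2; norm_num at h2
    simp [h, h1]
    linarith
  · have h1 := ultimateRatio_eq_one h
    simp [h, h1]
    norm_num
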